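/- **Setting.** A (Schrödinger) graph $\Gamma$ consists of finitely many rays $[0,\infty)$ and finitely many interior edges $[0,\ell_e]$, $\ell_e>0$, with real continuous potentials $q$ satisfying $\int(1+x)|q(x)|\,dx<\infty$ on every ray and edge, and a self-adjoint operator $\mathcal L=-\frac{d^2}{dx^2}+q$ on it. The operator is given by self-adjoint boundary conditions, i.e. by a Lagrange plane in the space of boundary values $(\psi,\partial\psi)$ at all end points of rays and edges ($\partial$ the derivative into the edge) for the form $\sum(\bar\phi\,\partial\psi-\overline{\partial\phi}\,\psi)$; the vertices of the graph are encoded in these conditions. Here the complement of a subspace $W$ for a skew-hermitian form is $W^\perp=\{v:\langle w,v\rangle=0\ \forall w\in W\}$, and $W$ is a Lagrange plane if $W^\perp=W$. Fix $k\in\mathbb R\setminus\{0\}$. Let $H(\Gamma)$ be the space of solutions of $-\psi''+q\psi=k^2\psi$ on the rays (no boundary condition), with the form $\langle\phi,\psi\rangle=\frac1k\sum_r(\bar\phi_r\psi_r'-\bar\phi_r'\psi_r)$, which does not depend on the points of evaluation. Let $\Lambda(\Gamma)\subset H(\Gamma)$ be the set of restrictions to the rays of the generalised eigenfunctions of $\mathcal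 L$, i.e. of the solutions on all rays and edges of $\Gamma$ that satisfy the boundary conditions. Let $f_{\pm,j}\in H(\Gamma)$ be the Jost solutions: $f_{\pm,j}$ vanishes off ray $j$ and $f_{\pm,j}(x)\,e^{\mp ikx}\to1$ as $x\to\infty$ on ray $j$. A matrix $S$ is the scattering matrix of $\Gamma$ at $k$ if the functions $f_{-,i}+\sum_jS_{ij}f_{+,j}$ form a basis of $\Lambda(\Gamma)$. **Linking.** Let $\Gamma'$ have rays $1,\dots,p+n'$ and $\Gamma''$ rays $1,\dots,p+n''$, with scattering matrices at $k$, in blocks with the first $p$ rays first, $$S'=\begin{pmatrix}S'_{(p)}&S'_{(p,n')}\\S'_{(n',p)}&S'_{(n')}\end{pmatrix},\qquad S''=\begin{pmatrix}S''_{(p)}&S''_{(p,n'')}\\S''_{(n'',p)}&S''_{(n'')}\end{pmatrix}.$$ For $j\le p$ let $a_j',a_j''\ge0$, $a_j=a_j'+a_j''>0$, be such that the potentials on the $j$-th rays of $\Gamma'$ and $\Gamma''$ are supported in $[0,a_j']$ and $[0,a_j'']$. Truncate these rays at $a_j'$ and $a_j''$ and join them end to end to an interior edge of length $a_j$. This gives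 a graph $\Gamma$, whose rays are the remaining $n''$ rays of $\Gamma''$ followed by the remaining $n'$ rays of $\Gamma'$, with the operator defined by the potentials and boundary conditions of $\Gamma'$ and $\Gamma''$. An element $(\psi',\psi'')$ of $H=H(\Gamma')\oplus H(\Gamma'')$ *matches* if, for every $j\le p$, $\psi'_j(a_j')=\psi''_j(a_j'')$ and $(\psi'_j)'(a_j')=-(\psi''_j)'(a_j'')$ on the $j$-th rays. Let $N\subset H$ be the subspace of matching elements that vanish on all rays which are not linked, and $L_m=\Lambda(\Gamma')\oplus\Lambda(\Gamma'')$. **Claim.** (1) $N\subset N^\perp$, and $N^\perp$ is the space of all matching elements. The projection $(L_m\cap N^\perp)/N$ of $L_m\cap N^\perp$ to $N^\perp/N$ is a Lagrange plane in $N^\perp/N$ with the induced form. Restriction to the rays of $\Gamma$ induces a form-preserving linear isomorphism $N^\perp/N\to H(\Gamma)$ that maps $(L_m\cap N^\perp)/N$ onto $\Lambda(\Gamma)$. (2) Let $\zeta=\operatorname{diag}(e^{-ika_1},\dots,e^{-ika_p})$. If $\begin{pmatrix}\zeta&-S'_{(p)}\\-S''_{(p)}&\zeta\end{pmatrix}$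 is invertible, then $\Gamma$ has exactly one scattering matrix at $k$, namely $$S=\begin{pmatrix}S''_{(n'')}&0\\0&S'_{(n')}\end{pmatrix}+\begin{pmatrix}S''_{(n'',p)}&0\\0&S'_{(n',p)}\end{pmatrix}\begin{pmatrix}\zeta&-S'_{(p)}\\-S''_{(p)}&\zeta\end{pmatrix}^{-1}\begin{pmatrix}0&S'_{(p,n')}\\S''_{(p,n'')}&0\end{pmatrix}.$$ -/

import Mathlib

open Set Filter Topology Complex
open scoped ComplexConjugate

noncomputable section

/-! ### Hermitian symplectic linear algebra -/

/-- Sesquilinear forms on `V`, conjugate-linear in the first argument. -/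
abbrev SesqForm (V : Type*) [AddCommGroup V] [Module ℂ V] : Type _ := V →ₗ⋆[ℂ] V →ₗ[ℂ] ℂ

/-- Skew-hermitian forms. -/
def SkewHermitian {V : Type*} [AddCommGroup V] [Module ℂ V] (ω : SesqForm V) : Prop :=
  ∀ x y, ω y x = -conj (ω x y)

/-- The skew-orthogonal complement `N^⊥ = {v | ω n v = 0 for all n ∈ N}`. -/
def perp {V : Type*} [AddCommGroup V] [Module ℂ V] (ω : SesqForm V) (N : Submodule ℂ V) :
    Submodule ℂ V where
  carrier := {v | ∀ n ∈ N, ω n v = 0}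
  add_mem' := by
    intro a b ha hb n hn
    rw [map_add, ha n hn, hb n hn, add_zero]
  zero_mem' := by
    intro n _
    exact map_zero _
  smul_mem' := by
    intro c a ha n hn
    rw [map_smul, ha n hn, smul_zero]

/-- The pull-back of a form along a linear map. -/
def pullForm {U V : Type*} [AddCommGroup U] [Module ℂ U] [AddCommGroup V] [Module ℂ V]
    (ω : SesqForm V) (f : U →ₗ[ℂ] V) : SesqForm U :=
  LinearMap.mk₂'ₛₗ (starRingEnd ℂ) (RingHom.id ℂ) (fun x y => ω (f x) (f y))
    (by intro x y z; simp) (by intro c x y; simp) (by intro x y z; simp) (by intro c x y; simp)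

/-- A Lagrange plane is a subspace equal to its own skew-orthogonal complement; in a nondegenerate
space of dimension `2n` with a Lagrange plane, these are the isotropic subspaces of dimension
`n`. -/
def IsLagrange {V : Type*} [AddCommGroup V] [Module ℂ V] (ω : SesqForm V) (W : Submodule ℂ V) :
    Prop :=
  perp ω W = W

/-- The quotient `N^⊥ / N` (for isotropic `N`). -/
abbrev Reduced {V : Type*} [AddCommGroup V] [Module ℂ V] (ω : SesqForm V) (N : Submodule ℂ V) :
    Type _ :=
  ↥(perp ω N) ⧸ N.submoduleOf (perp ω N)

/-- The form induced on `N^⊥ / N`. -/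
def reducedForm {V : Type*} [AddCommGroup V] [Module ℂ V] (ω : SesqForm V) (hω : SkewHermitian ω)
    (N : Submodule ℂ V) : SesqForm (Reduced ω N) :=
  (N.submoduleOf (perp ω N)).liftQ
    ({ toFun := fun x => (N.submoduleOf (perp ω N)).liftQ ((ω x.1).comp (perp ω N).subtype) (by
          intro y hy
          have h : ω y.1 x.1 = 0 := x.2 y.1 hy
          simp [hω y.1 x.1, h])
       map_add' := by
          intro x y
          ext z
          simp
       map_smul' := by
          intro c x
          ext z
          simp } : ↥(perp ω N) →ₗ⋆[ℂ] (Reduced ω N →ₗ[ℂ] ℂ))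
    (by
      intro x hx
      ext z
      exact z.2 x.1 hx)

theorem reducedForm_mk {V : Type*} [AddCommGroup V] [Module ℂ V] (ω : SesqForm V)
    (hω : SkewHermitian ω) (N : Submodule ℂ V) (x y : ↥(perp ω N)) :
    reducedForm ω hω N (Submodule.Quotient.mk x) (Submodule.Quotient.mk y) = ω x.1 y.1 :=
  rfl

/-- The projection `(W ∩ N^⊥) / N` of a subspace `W` to `N^⊥ / N`. -/
def reducedPlane {V : Type*} [AddCommGroup V] [Module ℂ V] (ω : SesqForm V)
    (N W : Submodule ℂ V) : Submodule ℂ (Reduced ω N) :=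
  (W.submoduleOf (perp ω N)).map (N.submoduleOf (perp ω N)).mkQ

/-- The canonical hermitian symplectic form on Cauchy data `(value, derivative)` at a finite set
of points, `∑ᵢ (conj uᵢ * vᵢ' - conj uᵢ' * vᵢ)`. -/
def dataForm (ι : Type*) [Fintype ι] : SesqForm (ι → ℂ × ℂ) :=
  LinearMap.mk₂'ₛₗ (starRingEnd ℂ) (RingHom.id ℂ)
    (fun u v => ∑ i, (conj (u i).1 * (v i).2 - conj (u i).2 * (v i).1))
    (by
      intro u₁ u₂ v
      rw [← Finset.sum_add_distrib]
      refine Finset.sum_congr rfl fun i _ => ?_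
      simp only [Pi.add_apply, Prod.fst_add, Prod.snd_add, map_add]
      ring)
    (by
      intro c u v
      rw [smul_eq_mul, Finset.mul_sum]
      refine Finset.sum_congr rfl fun i _ => ?_
      simp only [Pi.smul_apply, Prod.smul_fst, Prod.smul_snd, smul_eq_mul, map_mul]
      ring)
    (by
      intro u v₁ v₂
      rw [← Finset.sum_add_distrib]
      refine Finset.sum_congr rfl fun i _ => ?_
      simp only [Pi.add_apply, Prod.fst_add, Prod.snd_add]
      ring)
    (by
      intro c u v
      rw [RingHom.id_apply, smul_eq_mul, Finset.mul_sum]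
      refine Finset.sum_congr rfl fun i _ => ?_
      simp only [Pi.smul_apply, Prod.smul_fst, Prod.smul_snd, smul_eq_mul]
      ring)

theorem dataForm_apply (ι : Type*) [Fintype ι] (u v : ι → ℂ × ℂ) :
    dataForm ι u v = ∑ i, (conj (u i).1 * (v i).2 - conj (u i).2 * (v i).1) :=
  rfl

theorem dataForm_skew (ι : Type*) [Fintype ι] : SkewHermitian (dataForm ι) := by
  intro x y
  rw [dataForm_apply, dataForm_apply, map_sum, ← Finset.sum_neg_distrib]
  refine Finset.sum_congr rfl fun i _ => ?_
  simp only [map_sub, map_mul, Complex.conj_conj]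
  ring

/-! ### Solutions of the Schrödinger equation -/

/-- `f` solves `-f'' + q f = lam f` on the closed interval `s` (one-sided derivatives at the end
points; `g` is the derivative of `f`). For `q` continuous on `s` such an `f` is `C²` on `s`. -/
def IsSolution (q : ℝ → ℝ) (lam : ℝ) (s : Set ℝ) (f : ℝ → ℂ) : Prop :=
  ∃ g : ℝ → ℂ, ∀ x ∈ s, HasDerivWithinAt f (g x) s x ∧
    HasDerivWithinAt g (((q x : ℂ) - (lam : ℂ)) * f x) s x

/-- The space of solutions on `s`. A function on `s` is represented by its extension by zero. -/
def solSpace (q : ℝ → ℝ) (lam : ℝ) (s : Set ℝ) : Submodule ℂ (ℝ → ℂ) where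
  carrier := {f | (∀ x ∉ s, f x = 0) ∧ IsSolution q lam s f}
  add_mem' := by
    rintro f₁ f₂ ⟨h₁, g₁, H₁⟩ ⟨h₂, g₂, H₂⟩
    refine ⟨fun x hx => by simp [h₁ x hx, h₂ x hx], g₁ + g₂, fun x hx => ⟨?_, ?_⟩⟩
    · exact (H₁ x hx).1.add (H₂ x hx).1
    · rw [Pi.add_apply, mul_add]
      exact (H₁ x hx).2.add (H₂ x hx).2
  zero_mem' := by
    refine ⟨fun x _ => rfl, 0, fun x _ => ⟨?_, ?_⟩⟩
    · exact hasDerivWithinAt_const x _ (0 : ℂ)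
    · rw [Pi.zero_apply, mul_zero]
      exact hasDerivWithinAt_const x _ (0 : ℂ)
  smul_mem' := by
    rintro c f ⟨h, g, H⟩
    refine ⟨fun x hx => by simp [h x hx], c • g, fun x hx => ⟨?_, ?_⟩⟩
    · exact (H x hx).1.const_smul c
    · rw [Pi.smul_apply, smul_eq_mul, mul_left_comm, ← smul_eq_mul c]
      exact (H x hx).2.const_smul c

theorem solSpace_differentiable {q : ℝ → ℝ} {lam : ℝ} {s : Set ℝ} (f : solSpace q lam s) {x : ℝ}
    (hx : x ∈ s) : DifferentiableWithinAt ℝ f.1 s x := by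
  obtain ⟨g, H⟩ := f.2.2
  exact (H x hx).1.differentiableWithinAt

/-- Cauchy data `(f x, f' x)` of a solution at a point `x` of `s`. -/
def cauchyData (q : ℝ → ℝ) (lam : ℝ) (s : Set ℝ) (x : ℝ) (hx : x ∈ s) :
    solSpace q lam s →ₗ[ℂ] ℂ × ℂ where
  toFun f := (f.1 x, derivWithin f.1 s x)
  map_add' := by
    intro f g
    ext
    · rfl
    · exact derivWithin_add (solSpace_differentiable f hx) (solSpace_differentiable g hx)
  map_smul' := by
    intro c f
    ext
    · rfl
    · exact derivWithin_const_smul c (solSpace_differentiable f hx)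

/-- Reversal of the direction of differentiation on Cauchy data. -/
def flipData : ℂ × ℂ →ₗ[ℂ] ℂ × ℂ := LinearMap.prodMap LinearMap.id (-LinearMap.id)

/-- `f ≃ e^{iκx}` for large `x`. -/
def AsympExp (κ : ℝ) (f : ℝ → ℂ) : Prop :=
  Tendsto (fun x : ℝ => f x / exp (I * κ * x)) atTop (𝓝 1)

/-! ### Graphs with self-adjoint Schrödinger operators -/

/-- The end points of the edges of a graph with rays `R` and interior edges `E`: the origins of
the rays, the initial end points and the terminal end points of the interior edges. -/
abbrev EndPoint (R E : Type*) : Type _ := R ⊕ (E ⊕ E)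

/-- A graph with finitely many rays `[0, ∞)` (indexed by `R`) and interior edges `[0, len e]`
(indexed by `E`), with a self-adjoint Schrödinger operator `-d²/dx² + q`: real continuous
potentials with finite first moment, and self-adjoint boundary conditions, that is, a Lagrange
plane `bc` in the space of boundary values. The boundary values at an end point are the value
of the function and its derivative in the direction pointing into the edge. How the edges are
attached at the vertices is encoded in the boundary conditions. -/
structure SchrodingerGraph (R E : Type*) [Fintype R] [Fintype E] where
  len : E → ℝ
  len_pos : ∀ e, 0 < len e
  rayPot : R → ℝ → ℝ
  rayPot_cont : ∀ r, ContinuousOn (rayPot r) (Ici 0)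
  rayPot_moment : ∀ r, MeasureTheory.IntegrableOn (fun x => (1 + x) * |rayPot r x|) (Ici 0)
  edgePot : E → ℝ → ℝ
  edgePot_cont : ∀ e, ContinuousOn (edgePot e) (Icc 0 (len e))
  bc : Submodule ℂ (EndPoint R E → ℂ × ℂ)
  bc_lagrange : IsLagrange (dataForm (EndPoint R E)) bc

namespace SchrodingerGraph

variable {R E : Type*} [Fintype R] [Fintype E]

/-- The asymptotic space `H(Γ, k²)`: solutions at energy `k²` on the rays, with no boundary
condition. -/
abbrev AsympSpace (G : SchrodingerGraph R E) (k : ℝ) : Type _ :=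
  ∀ r, solSpace (G.rayPot r) (k ^ 2) (Ici 0)

/-- Solutions at energy `k²` on the interior edges, with no boundary condition. -/
abbrev EdgeSpace (G : SchrodingerGraph R E) (k : ℝ) : Type _ :=
  ∀ e, solSpace (G.edgePot e) (k ^ 2) (Icc 0 (G.len e))

/-- Cauchy data at the origins of the rays. -/
def rayData (G : SchrodingerGraph R E) (k : ℝ) : G.AsympSpace k →ₗ[ℂ] (R → ℂ × ℂ) :=
  LinearMap.pi fun r =>
    (cauchyData (G.rayPot r) (k ^ 2) (Ici 0) 0 self_mem_Ici).comp (LinearMap.proj r)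

/-- The form `(1/k) ∑ᵣ (conj φᵣ ψᵣ' - conj φᵣ' ψᵣ)` on the asymptotic space. The Wronskian of two
solutions on a ray is constant; it is evaluated at the origin of the ray. -/
def asympForm (G : SchrodingerGraph R E) (k : ℝ) : SesqForm (G.AsympSpace k) :=
  ((k : ℂ)⁻¹) • pullForm (dataForm R) (G.rayData k)

theorem asympForm_apply (G : SchrodingerGraph R E) (k : ℝ) (φ ψ : G.AsympSpace k) :
    G.asympForm k φ ψ = (k : ℂ)⁻¹ * ∑ r, (conj ((φ r).1 0) * derivWithin (ψ r).1 (Ici 0) 0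
      - conj (derivWithin (φ r).1 (Ici 0) 0) * (ψ r).1 0) :=
  rfl

theorem asympForm_skew (G : SchrodingerGraph R E) (k : ℝ) : SkewHermitian (G.asympForm k) := by
  intro x y
  have h := dataForm_skew R (G.rayData k x) (G.rayData k y)
  change (k : ℂ)⁻¹ * dataForm R (G.rayData k y) (G.rayData k x) =
    -conj ((k : ℂ)⁻¹ * dataForm R (G.rayData k x) (G.rayData k y))
  rw [h, map_mul, map_inv₀, Complex.conj_ofReal, mul_neg]

/-- The boundary values of a function on the graph. -/
def boundaryValues (G : SchrodingerGraph R E) (k : ℝ) :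
    (G.AsympSpace k × G.EdgeSpace k) →ₗ[ℂ] (EndPoint R E → ℂ × ℂ) :=
  LinearMap.pi fun v =>
    match v with
    | .inl r =>
        (cauchyData (G.rayPot r) (k ^ 2) (Ici 0) 0 self_mem_Ici).comp
          ((LinearMap.proj r).comp (LinearMap.fst ℂ _ _))
    | .inr (.inl e) =>
        (cauchyData (G.edgePot e) (k ^ 2) (Icc 0 (G.len e)) 0
          (left_mem_Icc.2 (G.len_pos e).le)).comp
          ((LinearMap.proj e).comp (LinearMap.snd ℂ _ _))
    | .inr (.inr e) =>
        flipData.comp ((cauchyData (G.edgePot e) (k ^ 2) (Icc 0 (G.len e)) (G.len e)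
          (right_mem_Icc.2 (G.len_pos e).le)).comp
          ((LinearMap.proj e).comp (LinearMap.snd ℂ _ _)))

/-- The generalised eigenfunctions at energy `k²`: solutions on all rays and interior edges that
satisfy the boundary conditions. -/
def eigenfunctions (G : SchrodingerGraph R E) (k : ℝ) :
    Submodule ℂ (G.AsympSpace k × G.EdgeSpace k) :=
  G.bc.comap (G.boundaryValues k)

/-- The generalised eigenspace on the rays: restrictions of generalised eigenfunctions to the
rays. -/
def eigenplane (G : SchrodingerGraph R E) (k : ℝ) : Submodule ℂ (G.AsympSpace k) :=
  (G.eigenfunctions k).map (LinearMap.fst ℂ _ _)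

/-- The scattering wave `ψᵢ = f₋,ᵢ + ∑ⱼ Sᵢⱼ f₊,ⱼ`, where `f₊,ⱼ` and `f₋,ⱼ` live on ray `j`. -/
def scatteringWave [DecidableEq R] (G : SchrodingerGraph R E) (k : ℝ)
    (fp fm : G.AsympSpace k) (S : Matrix R R ℂ) (i : R) : G.AsympSpace k :=
  Pi.single i (fm i) + ∑ j, S i j • Pi.single j (fp j)

/-- `S` is the scattering matrix at `k`: with the Jost solutions `f_± ≃ e^{±ikx}` on the rays, the
waves `f₋,ᵢ + ∑ⱼ Sᵢⱼ f₊,ⱼ` form a basis of the generalised eigenspace on the rays. -/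
def IsScatteringMatrix [DecidableEq R] (G : SchrodingerGraph R E) (k : ℝ) (S : Matrix R R ℂ) :
    Prop :=
  ∃ fp fm : G.AsympSpace k,
    (∀ r, AsympExp k (fp r).1) ∧ (∀ r, AsympExp (-k) (fm r).1) ∧
    LinearIndependent ℂ (G.scatteringWave k fp fm S) ∧
    Submodule.span ℂ (range (G.scatteringWave k fp fm S)) = G.eigenplane k

end SchrodingerGraph

/-! ### Linking two graphs -/

/-- Data for linking the ray `inl i` of `G₁` to the ray `inl i` of `G₂` for each `i : P`: the
rays are truncated at `a₁ i` and `a₂ i`, outside of the support of their potentials. -/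
structure Linking {P N₁ N₂ E₁ E₂ : Type*} [Fintype P] [Fintype N₁] [Fintype N₂] [Fintype E₁]
    [Fintype E₂] (G₁ : SchrodingerGraph (P ⊕ N₁) E₁) (G₂ : SchrodingerGraph (P ⊕ N₂) E₂) where
  a₁ : P → ℝ
  a₂ : P → ℝ
  a₁_nonneg : ∀ i, 0 ≤ a₁ i
  a₂_nonneg : ∀ i, 0 ≤ a₂ i
  length_pos : ∀ i, 0 < a₁ i + a₂ i
  supp₁ : ∀ i x, a₁ i < x → G₁.rayPot (Sum.inl i) x = 0
  supp₂ : ∀ i x, a₂ i < x → G₂.rayPot (Sum.inl i) x = 0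

/-- The place of an end point of an edge of the first graph in the linked graph: the origin of the
linking ray `i` becomes the initial end point of the linking edge `i`. -/
def endPoint₁ {P N₁ N₂ E₁ E₂ : Type*} :
    EndPoint (P ⊕ N₁) E₁ → EndPoint (N₂ ⊕ N₁) ((E₁ ⊕ E₂) ⊕ P)
  | .inl (.inl i) => .inr (.inl (.inr i))
  | .inl (.inr j) => .inl (.inr j)
  | .inr (.inl e) => .inr (.inl (.inl (.inl e)))
  | .inr (.inr e) => .inr (.inr (.inl (.inl e)))

/-- The place of an end point of an edge of the second graph in the linked graph: the origin of the
linking ray `i` becomes the terminal end point of the linking edge `i`. -/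
def endPoint₂ {P N₁ N₂ E₁ E₂ : Type*} :
    EndPoint (P ⊕ N₂) E₂ → EndPoint (N₂ ⊕ N₁) ((E₁ ⊕ E₂) ⊕ P)
  | .inl (.inl i) => .inr (.inr (.inr i))
  | .inl (.inr j) => .inl (.inl j)
  | .inr (.inl e) => .inr (.inl (.inl (.inr e)))
  | .inr (.inr e) => .inr (.inr (.inl (.inr e)))

/-- Boundary conditions of the linked graph: those of both graphs. -/
def linkedBc {P N₁ N₂ E₁ E₂ : Type*} (W₁ : Submodule ℂ (EndPoint (P ⊕ N₁) E₁ → ℂ × ℂ))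
    (W₂ : Submodule ℂ (EndPoint (P ⊕ N₂) E₂ → ℂ × ℂ)) :
    Submodule ℂ (EndPoint (N₂ ⊕ N₁) ((E₁ ⊕ E₂) ⊕ P) → ℂ × ℂ) :=
  W₁.comap (LinearMap.funLeft ℂ (ℂ × ℂ) endPoint₁) ⊓
    W₂.comap (LinearMap.funLeft ℂ (ℂ × ℂ) endPoint₂)

/-- Boundary values on the linked graph from boundary values on both graphs. -/
def glueData {P N₁ N₂ E₁ E₂ : Type*} (u₁ : EndPoint (P ⊕ N₁) E₁ → ℂ × ℂ)
    (u₂ : EndPoint (P ⊕ N₂) E₂ → ℂ × ℂ) : EndPoint (N₂ ⊕ N₁) ((E₁ ⊕ E₂) ⊕ P) → ℂ × ℂ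
  | .inl (.inl j) => u₂ (.inl (.inr j))
  | .inl (.inr j) => u₁ (.inl (.inr j))
  | .inr (.inl (.inl (.inl e))) => u₁ (.inr (.inl e))
  | .inr (.inl (.inl (.inr e))) => u₂ (.inr (.inl e))
  | .inr (.inl (.inr i)) => u₁ (.inl (.inl i))
  | .inr (.inr (.inl (.inl e))) => u₁ (.inr (.inr e))
  | .inr (.inr (.inl (.inr e))) => u₂ (.inr (.inr e))
  | .inr (.inr (.inr i)) => u₂ (.inl (.inl i))

theorem glueData_endPoint₁ {P N₁ N₂ E₁ E₂ : Type*} (u₁ : EndPoint (P ⊕ N₁) E₁ → ℂ × ℂ)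
    (u₂ : EndPoint (P ⊕ N₂) E₂ → ℂ × ℂ) :
    LinearMap.funLeft ℂ (ℂ × ℂ) endPoint₁ (glueData u₁ u₂) = u₁ := by
  funext v
  rcases v with (i | j) | (e | e) <;> rfl

theorem glueData_endPoint₂ {P N₁ N₂ E₁ E₂ : Type*} (u₁ : EndPoint (P ⊕ N₁) E₁ → ℂ × ℂ)
    (u₂ : EndPoint (P ⊕ N₂) E₂ → ℂ × ℂ) :
    LinearMap.funLeft ℂ (ℂ × ℂ) endPoint₂ (glueData u₁ u₂) = u₂ := by
  funext v
  rcases v with (i | j) | (e | e) <;> rfl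

theorem dataForm_linked {P N₁ N₂ E₁ E₂ : Type*} [Fintype P] [Fintype N₁] [Fintype N₂] [Fintype E₁]
    [Fintype E₂] (u v : EndPoint (N₂ ⊕ N₁) ((E₁ ⊕ E₂) ⊕ P) → ℂ × ℂ) :
    dataForm _ u v =
      dataForm (EndPoint (P ⊕ N₁) E₁) (LinearMap.funLeft ℂ (ℂ × ℂ) endPoint₁ u)
        (LinearMap.funLeft ℂ (ℂ × ℂ) endPoint₁ v) +
      dataForm (EndPoint (P ⊕ N₂) E₂) (LinearMap.funLeft ℂ (ℂ × ℂ) endPoint₂ u)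
        (LinearMap.funLeft ℂ (ℂ × ℂ) endPoint₂ v) := by
  simp only [dataForm_apply, Fintype.sum_sum_type, LinearMap.funLeft_apply, endPoint₁, endPoint₂]
  ring

theorem linkedBc_lagrange {P N₁ N₂ E₁ E₂ : Type*} [Fintype P] [Fintype N₁] [Fintype N₂]
    [Fintype E₁] [Fintype E₂] (W₁ : Submodule ℂ (EndPoint (P ⊕ N₁) E₁ → ℂ × ℂ))
    (W₂ : Submodule ℂ (EndPoint (P ⊕ N₂) E₂ → ℂ × ℂ))
    (h₁ : IsLagrange (dataForm _) W₁) (h₂ : IsLagrange (dataForm _) W₂) :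
    IsLagrange (dataForm _) (linkedBc W₁ W₂) := by
  apply le_antisymm
  · intro v hv
    refine ⟨?_, ?_⟩
    · change _ ∈ W₁
      rw [← show perp _ W₁ = W₁ from h₁]
      intro w hw
      have h := hv (glueData w 0) (by
        refine ⟨?_, ?_⟩
        · change _ ∈ W₁
          rw [glueData_endPoint₁]; exact hw
        · change _ ∈ W₂
          rw [glueData_endPoint₂]; exact W₂.zero_mem)
      rw [dataForm_linked, glueData_endPoint₁, glueData_endPoint₂, map_zero,
        LinearMap.zero_apply, add_zero] at h
      exact h
    · change _ ∈ W₂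
      rw [← show perp _ W₂ = W₂ from h₂]
      intro w hw
      have h := hv (glueData 0 w) (by
        refine ⟨?_, ?_⟩
        · change _ ∈ W₁
          rw [glueData_endPoint₁]; exact W₁.zero_mem
        · change _ ∈ W₂
          rw [glueData_endPoint₂]; exact hw)
      rw [dataForm_linked, glueData_endPoint₁, glueData_endPoint₂, map_zero,
        LinearMap.zero_apply, zero_add] at h
      exact h
  · rintro v ⟨hv₁, hv₂⟩ u ⟨hu₁, hu₂⟩
    change _ ∈ W₁ at hv₁ hu₁
    change _ ∈ W₂ at hv₂ hu₂
    rw [← show perp _ W₁ = W₁ from h₁] at hv₁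
    rw [← show perp _ W₂ = W₂ from h₂] at hv₂
    rw [dataForm_linked, hv₁ _ hu₁, hv₂ _ hu₂, add_zero]

/-- The potential on the edge of length `a + b` formed by joining `[0, a]` and `[0, b]` end to
end. -/
def joinPot (q₁ q₂ : ℝ → ℝ) (a b x : ℝ) : ℝ := if x ≤ a then q₁ x else q₂ (a + b - x)

theorem eq_zero_of_supp {q : ℝ → ℝ} (hq : ContinuousOn q (Ici 0)) {a : ℝ} (ha : 0 ≤ a)
    (h : ∀ x, a < x → q x = 0) : q a = 0 := by
  have h₁ : Tendsto q (𝓝[>] a) (𝓝 (q a)) :=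
    (hq a ha).mono_left (nhdsWithin_mono a fun x hx => ha.trans (le_of_lt hx))
  have h₂ : Tendsto q (𝓝[>] a) (𝓝 0) := by
    refine tendsto_const_nhds.congr' ?_
    filter_upwards [self_mem_nhdsWithin] with x hx using (h x hx).symm
  exact tendsto_nhds_unique h₁ h₂

theorem joinPot_cont {q₁ q₂ : ℝ → ℝ} {a b : ℝ} (ha : 0 ≤ a) (hb : 0 ≤ b)
    (h₁ : ContinuousOn q₁ (Ici 0)) (h₂ : ContinuousOn q₂ (Ici 0))
    (s₁ : ∀ x, a < x → q₁ x = 0) (s₂ : ∀ x, b < x → q₂ x = 0) :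
    ContinuousOn (joinPot q₁ q₂ a b) (Icc 0 (a + b)) := by
  have e₁ := eq_zero_of_supp h₁ ha s₁
  have e₂ := eq_zero_of_supp h₂ hb s₂
  have key : ∀ x ∈ Icc 0 (a + b), joinPot q₁ q₂ a b x = q₁ x + q₂ (a + b - x) := by
    intro x _
    unfold joinPot
    split_ifs with hx
    · rcases hx.lt_or_eq with hx | hx
      · rw [s₂ (a + b - x) (by linarith), add_zero]
      · rw [hx, add_sub_cancel_left, e₂, add_zero]
    · rw [s₁ x (not_le.1 hx), zero_add]
  refine ContinuousOn.congr ?_ key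
  refine (h₁.mono fun x hx => hx.1).add (h₂.comp (by fun_prop) fun x hx => ?_)
  exact sub_nonneg.2 hx.2

namespace Linking

variable {P N₁ N₂ E₁ E₂ : Type*} [Fintype P] [Fintype N₁] [Fintype N₂] [Fintype E₁]
  [Fintype E₂] {G₁ : SchrodingerGraph (P ⊕ N₁) E₁} {G₂ : SchrodingerGraph (P ⊕ N₂) E₂}

/-- The linked graph. Its rays are the remaining rays of `G₂` followed by those of `G₁`; its
interior edges are those of both graphs and the linking edges `[0, a₁ i + a₂ i]`, which are made of
the truncated rays `[0, a₁ i]` and `[0, a₂ i]` joined end to end. -/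
def linked (L : Linking G₁ G₂) : SchrodingerGraph (N₂ ⊕ N₁) ((E₁ ⊕ E₂) ⊕ P) where
  len
    | .inl (.inl e) => G₁.len e
    | .inl (.inr e) => G₂.len e
    | .inr i => L.a₁ i + L.a₂ i
  len_pos := by
    rintro ((e | e) | i)
    · exact G₁.len_pos e
    · exact G₂.len_pos e
    · exact L.length_pos i
  rayPot
    | .inl j => G₂.rayPot (.inr j)
    | .inr j => G₁.rayPot (.inr j)
  rayPot_cont := by
    rintro (j | j)
    · exact G₂.rayPot_cont _
    · exact G₁.rayPot_cont _
  rayPot_moment := by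
    rintro (j | j)
    · exact G₂.rayPot_moment _
    · exact G₁.rayPot_moment _
  edgePot
    | .inl (.inl e) => G₁.edgePot e
    | .inl (.inr e) => G₂.edgePot e
    | .inr i => joinPot (G₁.rayPot (.inl i)) (G₂.rayPot (.inl i)) (L.a₁ i) (L.a₂ i)
  edgePot_cont := by
    rintro ((e | e) | i)
    · exact G₁.edgePot_cont e
    · exact G₂.edgePot_cont e
    · exact joinPot_cont (L.a₁_nonneg i) (L.a₂_nonneg i) (G₁.rayPot_cont _) (G₂.rayPot_cont _)
        (L.supp₁ i) (L.supp₂ i)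
  bc := linkedBc G₁.bc G₂.bc
  bc_lagrange := linkedBc_lagrange _ _ G₁.bc_lagrange G₂.bc_lagrange

/-- The direct sum of the asymptotic spaces of the two graphs. -/
abbrev SumSpace (_L : Linking G₁ G₂) (k : ℝ) : Type _ := G₁.AsympSpace k × G₂.AsympSpace k

/-- The sum of the forms of the two graphs. -/
def sumForm (L : Linking G₁ G₂) (k : ℝ) : SesqForm (L.SumSpace k) :=
  pullForm (G₁.asympForm k) (LinearMap.fst ℂ _ _) +
    pullForm (G₂.asympForm k) (LinearMap.snd ℂ _ _)

theorem sumForm_apply (L : Linking G₁ G₂) (k : ℝ) (φ ψ : L.SumSpace k) :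
    L.sumForm k φ ψ = G₁.asympForm k φ.1 ψ.1 + G₂.asympForm k φ.2 ψ.2 :=
  rfl

theorem sumForm_skew (L : Linking G₁ G₂) (k : ℝ) : SkewHermitian (L.sumForm k) := by
  intro x y
  rw [sumForm_apply, sumForm_apply, G₁.asympForm_skew k x.1 y.1, G₂.asympForm_skew k x.2 y.2,
    map_add, neg_add]

/-- The direct sum of the generalised eigenspaces of the two graphs. -/
def sumPlane (L : Linking G₁ G₂) (k : ℝ) : Submodule ℂ (L.SumSpace k) :=
  (G₁.eigenplane k).prod (G₂.eigenplane k)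

/-- Cauchy data of `ψ.1` at `a₁ i` on the linking ray `i` of `G₁`. -/
def cutData₁ (L : Linking G₁ G₂) (k : ℝ) (i : P) : L.SumSpace k →ₗ[ℂ] ℂ × ℂ :=
  (cauchyData _ _ _ (L.a₁ i) (L.a₁_nonneg i)).comp
    ((LinearMap.proj (Sum.inl i)).comp (LinearMap.fst ℂ (G₁.AsympSpace k) (G₂.AsympSpace k)))

/-- Cauchy data of `ψ.2` at `a₂ i` on the linking ray `i` of `G₂`. -/
def cutData₂ (L : Linking G₁ G₂) (k : ℝ) (i : P) : L.SumSpace k →ₗ[ℂ] ℂ × ℂ :=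
  (cauchyData _ _ _ (L.a₂ i) (L.a₂_nonneg i)).comp
    ((LinearMap.proj (Sum.inl i)).comp (LinearMap.snd ℂ (G₁.AsympSpace k) (G₂.AsympSpace k)))

/-- The elements that match on the linking rays: equal values and opposite derivatives at the
points of truncation. -/
def matching (L : Linking G₁ G₂) (k : ℝ) : Submodule ℂ (L.SumSpace k) :=
  ⨅ i, LinearMap.eqLocus (L.cutData₁ k i) (flipData.comp (L.cutData₂ k i))

/-- Restriction of an element of the sum space to the rays of the linked graph. -/
def restrict (L : Linking G₁ G₂) (k : ℝ) : L.SumSpace k →ₗ[ℂ] L.linked.AsympSpace k :=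
  LinearMap.pi fun r =>
    match r with
    | .inl j => (LinearMap.proj (Sum.inr j)).comp
        (LinearMap.snd ℂ (G₁.AsympSpace k) (G₂.AsympSpace k))
    | .inr j => (LinearMap.proj (Sum.inr j)).comp
        (LinearMap.fst ℂ (G₁.AsympSpace k) (G₂.AsympSpace k))

/-- The subspace `N` of the elements with support confined to the linking rays and which match
there. -/
def linkSpace (L : Linking G₁ G₂) (k : ℝ) : Submodule ℂ (L.SumSpace k) :=
  L.matching k ⊓ LinearMap.ker (L.restrict k)

/-- The diagonal matrix `ζ` with entries `e^{-ik aᵢ}`, where `aᵢ = a₁ i + a₂ i` is the length of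
the linking edge `i`. -/
def zeta [DecidableEq P] (L : Linking G₁ G₂) (k : ℝ) : Matrix P P ℂ :=
  Matrix.diagonal fun i => exp (-(I * k * (L.a₁ i + L.a₂ i : ℝ)))

/-- The matrix `[[ζ, -S₁_(p)], [-S₂_(p), ζ]]`. -/
def linkMatrix [DecidableEq P] (L : Linking G₁ G₂) (k : ℝ) (S₁ : Matrix (P ⊕ N₁) (P ⊕ N₁) ℂ)
    (S₂ : Matrix (P ⊕ N₂) (P ⊕ N₂) ℂ) : Matrix (P ⊕ P) (P ⊕ P) ℂ :=
  Matrix.fromBlocks (L.zeta k) (-S₁.toBlocks₁₁) (-S₂.toBlocks₁₁) (L.zeta k)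

end Linking

end

noncomputable section

/-! ### Solutions of the Schrödinger equation: Wronskian and uniqueness -/

/-! The proof is symplectic reduction. Wronskians are constant along a ray, so the form on `H` may
be evaluated at the cut points on the linking rays. It then splits into the cut terms and the form
of the remaining rays (`sumForm_eq`). Matching data are equal up to the sign of the derivative,
which reverses the Wronskian, so the cut terms of two matching elements cancel. Cut data can be
prescribed freely, hence nondegeneracy makes the complement of `N` exactly the matching space
(`perp_linkSpace`), and restriction to the remaining rays preserves the form and has kernel `N`
there.

An eigenplane is isotropic by Green's formula. A scattering matrix provides a basis of it with one
element per ray, half the dimension of the asymptotic space, so it is Lagrange; Lagrange planes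
survive reduction (`reducedPlane_isLagrange`). The reduced plane is the eigenplane of the linked
graph because matching solutions glue across the cut, and a solution on a linking edge conversely
determines solutions on the two rays by its Cauchy data at the cut.

For the formula, the `f₋` and `f₊` coefficients of an element of an eigenplane are row vectors `α`
and `α S`. Beyond the support of the potential the Jost solutions are exact exponentials, so
matching says that, up to the phase `ζ`, the incoming amplitudes on each side are the outgoing ones
of the other. This is a linear system for the amplitudes on the linking rays; its matrix is
`linkMatrix`, and eliminating them gives `S`. Uniqueness of `S` comes from that of the Jost
solutions. -/

/-- `g` is the derivative of `f` on `s`, and `f` solves `-f'' + q f = lam f` there. -/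
def IsSolPair (q : ℝ → ℝ) (lam : ℝ) (s : Set ℝ) (f g : ℝ → ℂ) : Prop :=
  ∀ x ∈ s, HasDerivWithinAt f (g x) s x ∧
    HasDerivWithinAt g (((q x : ℂ) - (lam : ℂ)) * f x) s x

/-- The hermitian Wronskian of Cauchy data. -/
def dataWronskian (u v : ℂ × ℂ) : ℂ := conj u.1 * v.2 - conj u.2 * v.1

theorem dataForm_eq_sum {ι : Type*} [Fintype ι] (u v : ι → ℂ × ℂ) :
    dataForm ι u v = ∑ i, dataWronskian (u i) (v i) :=
  rfl

theorem dataWronskian_flip (u v : ℂ × ℂ) :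
    dataWronskian (flipData u) (flipData v) = -dataWronskian u v := by
  simp [dataWronskian, flipData]
  ring

theorem flipData_flipData (u : ℂ × ℂ) : flipData (flipData u) = u := by
  simp [flipData]

theorem dataWronskian_zero_left (v : ℂ × ℂ) : dataWronskian 0 v = 0 := by
  simp [dataWronskian]

theorem eq_of_forall_dataWronskian {v w : ℂ × ℂ}
    (h : ∀ u, dataWronskian u v = dataWronskian u w) : v = w := by
  have h₁ := h (1, 0)
  have h₂ := h (0, 1)
  simp [dataWronskian] at h₁ h₂
  exact Prod.ext h₂ h₁

theorem IsSolPair.mono {q : ℝ → ℝ} {lam : ℝ} {s t : Set ℝ} {f g : ℝ → ℂ}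
    (h : IsSolPair q lam s f g) (hts : t ⊆ s) : IsSolPair q lam t f g :=
  fun x hx => ⟨(h x (hts hx)).1.mono hts, (h x (hts hx)).2.mono hts⟩

theorem IsSolPair.congr {q q' : ℝ → ℝ} {lam : ℝ} {s : Set ℝ} {f g f' g' : ℝ → ℂ}
    (h : IsSolPair q lam s f g) (hq : EqOn q' q s) (hf : EqOn f' f s) (hg : EqOn g' g s) :
    IsSolPair q' lam s f' g' := by
  intro x hx
  refine ⟨?_, ?_⟩
  · rw [hg hx]
    exact (h x hx).1.congr hf (hf hx)
  · rw [hq hx, hf hx]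
    exact (h x hx).2.congr hg (hg hx)

/-- At a point outside a closed set every number is a derivative within that set, so the derivatives
within the two pieces combine at all points of the union, the common end point included. -/
theorem IsSolPair.union {q : ℝ → ℝ} {lam : ℝ} {s t : Set ℝ} {f g : ℝ → ℂ}
    (hs : IsSolPair q lam s f g) (ht : IsSolPair q lam t f g) (cs : IsClosed s)
    (ct : IsClosed t) : IsSolPair q lam (s ∪ t) f g := by
  have key : ∀ {u : Set ℝ}, IsClosed u → ∀ {F : ℝ → ℂ} {c : ℂ} {x : ℝ},
      (x ∈ u → HasDerivWithinAt F c u x) → HasDerivWithinAt F c u x := by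
    intro u hu F c x h
    by_cases hx : x ∈ u
    · exact h hx
    · exact HasFDerivWithinAt.of_notMem_closure (by rwa [hu.closure_eq])
  exact fun x _ => ⟨(key cs fun h => (hs x h).1).union (key ct fun h => (ht x h).1),
    (key cs fun h => (hs x h).2).union (key ct fun h => (ht x h).2)⟩

/-- The equation is of second order, so reversing the direction only changes the sign of the first
derivative. This turns the second linking ray around when it is joined to the first. -/
theorem IsSolPair.reflect {q : ℝ → ℝ} {lam : ℝ} {s t : Set ℝ} {f g : ℝ → ℂ} (c : ℝ)
    (h : IsSolPair q lam s f g) (hst : MapsTo (fun x => c - x) t s) :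
    IsSolPair (fun x => q (c - x)) lam t (fun x => f (c - x)) (fun x => -g (c - x)) := by
  intro x hx
  have hr : HasDerivWithinAt (fun x : ℝ => c - x) (-1) t x :=
    (hasDerivWithinAt_id x t).const_sub c
  refine ⟨?_, ?_⟩
  · simpa [Function.comp_def] using (h _ (hst hx)).1.scomp x hr hst
  · simpa [Function.comp_def] using ((h _ (hst hx)).2.scomp x hr hst).fun_neg

/-- Since `q` and `lam` are real, the derivative of the Wronskian vanishes, and the mean value
inequality with constant zero applies on the convex set. -/
theorem IsSolPair.wronskian_eq {q : ℝ → ℝ} {lam : ℝ} {s : Set ℝ} (hs : Convex ℝ s)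
    {f₁ g₁ f₂ g₂ : ℝ → ℂ} (h₁ : IsSolPair q lam s f₁ g₁) (h₂ : IsSolPair q lam s f₂ g₂)
    {x y : ℝ} (hx : x ∈ s) (hy : y ∈ s) :
    dataWronskian (f₁ x, g₁ x) (f₂ x, g₂ x) = dataWronskian (f₁ y, g₁ y) (f₂ y, g₂ y) := by
  have hd : ∀ z ∈ s, HasDerivWithinAt
      (fun z => dataWronskian (f₁ z, g₁ z) (f₂ z, g₂ z)) 0 s z := by
    intro z hz
    have a := (h₁ z hz).1.star.mul (h₂ z hz).2
    have b := (h₁ z hz).2.star.mul (h₂ z hz).1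
    refine (a.sub b).congr_deriv ?_
    simp only [star_mul', star_sub, Complex.star_def, Complex.conj_ofReal]
    ring
  have := hs.norm_image_sub_le_of_norm_hasDerivWithin_le (C := 0) hd (by simp) hy hx
  rw [zero_mul] at this
  exact sub_eq_zero.1 (norm_le_zero_iff.1 this)

theorem IsSolPair.unique {q : ℝ → ℝ} {lam : ℝ} {s : Set ℝ} (hs : s.OrdConnected)
    (hq : ContinuousOn q s) {f₁ g₁ f₂ g₂ : ℝ → ℂ} (h₁ : IsSolPair q lam s f₁ g₁)
    (h₂ : IsSolPair q lam s f₂ g₂) {x₀ : ℝ} (hx₀ : x₀ ∈ s) (hf : f₁ x₀ = f₂ x₀)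
    (hg : g₁ x₀ = g₂ x₀) {x : ℝ} (hx : x ∈ s) : f₁ x = f₂ x ∧ g₁ x = g₂ x := by
  let v : ℝ → ℂ × ℂ → ℂ × ℂ := fun t u => (u.2, ((q t : ℂ) - (lam : ℂ)) * u.1)
  have hsub : uIcc x₀ x ⊆ s := hs.uIcc_subset hx₀ hx
  -- The potential need not be bounded on `s`, only on the compact interval between the two points;
  -- the `1` in the Lipschitz constant is for the first component of the system.
  obtain ⟨K, hK⟩ : ∃ K : NNReal, ∀ t ∈ uIcc x₀ x, LipschitzOnWith K (v t) univ := by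
    have hc : ContinuousOn (fun t => (q t : ℂ) - (lam : ℂ)) (uIcc x₀ x) :=
      (Complex.continuous_ofReal.comp_continuousOn (hq.mono hsub)).sub continuousOn_const
    obtain ⟨C, hC⟩ := isCompact_uIcc.exists_bound_of_continuousOn hc
    refine ⟨(max 1 C).toNNReal, fun t ht => (LipschitzWith.of_dist_le_mul fun u w => ?_).lipschitzOnWith⟩
    rw [Real.coe_toNNReal _ (zero_le_one.trans (le_max_left _ _)), Prod.dist_eq, Prod.dist_eq]
    refine max_le ?_ ?_
    · calc dist u.2 w.2 ≤ 1 * max (dist u.1 w.1) (dist u.2 w.2) := by simp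
        _ ≤ _ := by gcongr; exact le_max_left _ _
    · calc dist (((q t : ℂ) - (lam : ℂ)) * u.1) (((q t : ℂ) - (lam : ℂ)) * w.1)
          = ‖(q t : ℂ) - (lam : ℂ)‖ * dist u.1 w.1 := by
            rw [dist_eq_norm, dist_eq_norm, ← mul_sub, norm_mul]
        _ ≤ max 1 C * max (dist u.1 w.1) (dist u.2 w.2) := by
            gcongr
            · exact (hC t ht).trans (le_max_right _ _)
            · exact le_max_left _ _
  have hd : ∀ {f g : ℝ → ℂ}, IsSolPair q lam s f g → ∀ t ∈ uIcc x₀ x,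
      HasDerivWithinAt (fun t => (f t, g t)) (v t (f t, g t)) (uIcc x₀ x) t := fun h t ht =>
    ((h t (hsub ht)).1.mono hsub).prodMk ((h t (hsub ht)).2.mono hsub)
  have hcont : ∀ {f g : ℝ → ℂ}, IsSolPair q lam s f g →
      ContinuousOn (fun t => (f t, g t)) (uIcc x₀ x) := fun h t ht =>
    (hd h t ht).continuousWithinAt
  have h₀ : (fun t => (f₁ t, g₁ t)) x₀ = (fun t => (f₂ t, g₂ t)) x₀ := Prod.ext hf hg
  have key : (fun t => (f₁ t, g₁ t)) x = (fun t => (f₂ t, g₂ t)) x := by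
    rcases le_total x₀ x with hle | hle
    · rw [uIcc_of_le hle] at hK hd hcont
      have hr : ∀ {f g : ℝ → ℂ}, IsSolPair q lam s f g → ∀ t ∈ Ico x₀ x,
          HasDerivWithinAt (fun t => (f t, g t)) (v t (f t, g t)) (Ici t) t := fun h t ht =>
        (hd h t (Ico_subset_Icc_self ht)).mono_of_mem_nhdsWithin (Icc_mem_nhdsGE_of_mem ht)
      exact ODE_solution_unique_of_mem_Icc_right
        (fun t ht => hK t (Ico_subset_Icc_self ht)) (hcont h₁) (hr h₁) (fun _ _ => trivial)
        (hcont h₂) (hr h₂) (fun _ _ => trivial) h₀ (right_mem_Icc.2 hle)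
    · rw [uIcc_of_ge hle] at hK hd hcont
      have hl : ∀ {f g : ℝ → ℂ}, IsSolPair q lam s f g → ∀ t ∈ Ioc x x₀,
          HasDerivWithinAt (fun t => (f t, g t)) (v t (f t, g t)) (Iic t) t := fun h t ht =>
        (hd h t (Ioc_subset_Icc_self ht)).mono_of_mem_nhdsWithin (Icc_mem_nhdsLE_of_mem ht)
      exact ODE_solution_unique_of_mem_Icc_left
        (fun t ht => hK t (Ioc_subset_Icc_self ht)) (hcont h₁) (hl h₁) (fun _ _ => trivial)
        (hcont h₂) (hl h₂) (fun _ _ => trivial) h₀ (left_mem_Icc.2 hle)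
  exact ⟨congrArg Prod.fst key, congrArg Prod.snd key⟩

theorem IsSolPair.derivWithin_eq {q : ℝ → ℝ} {lam : ℝ} {s : Set ℝ} {f g : ℝ → ℂ}
    (h : IsSolPair q lam s f g) (hs : UniqueDiffOn ℝ s) {x : ℝ} (hx : x ∈ s) :
    derivWithin f s x = g x :=
  (h x hx).1.derivWithin (hs x hx)

theorem solSpace_isSolPair {q : ℝ → ℝ} {lam : ℝ} {s : Set ℝ} (hs : UniqueDiffOn ℝ s)
    (f : solSpace q lam s) : IsSolPair q lam s f.1 (derivWithin f.1 s) := by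
  obtain ⟨g, H⟩ := f.2.2
  have H' : IsSolPair q lam s f.1 g := H
  exact H'.congr (fun _ _ => rfl) (fun _ _ => rfl) fun x hx => H'.derivWithin_eq hs hx

/-- The element of the solution space given by a solution on `s`. -/
def IsSolPair.toSolSpace {q : ℝ → ℝ} {lam : ℝ} {s : Set ℝ} {f g : ℝ → ℂ}
    (h : IsSolPair q lam s f g) : solSpace q lam s :=
  ⟨s.indicator f, fun _ hx => indicator_of_notMem hx f, g,
    h.congr (fun _ _ => rfl) (fun _ hx => indicator_of_mem hx f) fun _ _ => rfl⟩

theorem IsSolPair.toSolSpace_apply {q : ℝ → ℝ} {lam : ℝ} {s : Set ℝ} {f g : ℝ → ℂ}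
    (h : IsSolPair q lam s f g) {x : ℝ} (hx : x ∈ s) : h.toSolSpace.1 x = f x :=
  indicator_of_mem hx f

theorem IsSolPair.cauchyData_toSolSpace {q : ℝ → ℝ} {lam : ℝ} {s : Set ℝ} {f g : ℝ → ℂ}
    (h : IsSolPair q lam s f g) (hs : UniqueDiffOn ℝ s) {x : ℝ} (hx : x ∈ s) :
    cauchyData q lam s x hx h.toSolSpace = (f x, g x) := by
  refine Prod.ext (h.toSolSpace_apply hx) ?_
  have h' : IsSolPair q lam s h.toSolSpace.1 g :=
    h.congr (fun _ _ => rfl) (fun _ hx => indicator_of_mem hx f) fun _ _ => rfl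
  exact h'.derivWithin_eq hs hx

theorem cauchyData_wronskian_eq {q : ℝ → ℝ} {lam : ℝ} {s : Set ℝ} (hs : UniqueDiffOn ℝ s)
    (hc : Convex ℝ s) (f g : solSpace q lam s) {x y : ℝ} (hx : x ∈ s) (hy : y ∈ s) :
    dataWronskian (cauchyData q lam s x hx f) (cauchyData q lam s x hx g) =
      dataWronskian (cauchyData q lam s y hy f) (cauchyData q lam s y hy g) :=
  (solSpace_isSolPair hs f).wronskian_eq hc (solSpace_isSolPair hs g) hx hy

theorem cauchyData_injective {q : ℝ → ℝ} {lam : ℝ} {s : Set ℝ} (hs : UniqueDiffOn ℝ s)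
    (hc : s.OrdConnected) (hq : ContinuousOn q s) {x : ℝ} (hx : x ∈ s) :
    Function.Injective (cauchyData q lam s x hx) := by
  intro f g h
  refine Subtype.ext (funext fun y => ?_)
  by_cases hy : y ∈ s
  · exact ((solSpace_isSolPair hs f).unique hc hq (solSpace_isSolPair hs g) hx
      (congrArg Prod.fst h) (congrArg Prod.snd h) hy).1
  · rw [f.2.1 y hy, g.2.1 y hy]

/-! ### Jost solutions -/

/-- A shift by the half period `π / κ` changes the sign, so the limit is its own negative, hence
zero; but the modulus is constantly `‖B‖`. -/
theorem eq_zero_of_tendsto_mul_exp {κ : ℝ} (hκ : κ ≠ 0) {B ℓ : ℂ}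
    (h : Tendsto (fun x : ℝ => B * exp (I * κ * x)) atTop (𝓝 ℓ)) : B = 0 := by
  have h₂ := h.comp (tendsto_atTop_add_const_right atTop (Real.pi / κ) tendsto_id)
  have hx : (fun x : ℝ => B * exp (I * κ * x)) ∘ (fun x : ℝ => id x + Real.pi / κ) =
      fun x : ℝ => -(B * exp (I * κ * x)) := by
    funext x
    have : I * κ * ((x + Real.pi / κ : ℝ) : ℂ) = I * κ * x + Real.pi * I := by
      have : (κ : ℂ) ≠ 0 := by exact_mod_cast hκ
      push_cast
      field_simp
    simp only [Function.comp_apply, id_eq, this, Complex.exp_add, Complex.exp_pi_mul_I]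
    ring
  rw [hx] at h₂
  have hℓ : ℓ = 0 := by
    have := tendsto_nhds_unique h₂ h.neg
    exact self_eq_neg.1 (tendsto_nhds_unique h (by simpa using h₂.neg) ▸ this)
  have hn := h.norm
  have hc : (fun x : ℝ => ‖B * exp (I * κ * x)‖) = fun _ => ‖B‖ := by
    funext x
    rw [norm_mul, show I * κ * x = ((κ * x : ℝ) : ℂ) * I by push_cast; ring,
      Complex.norm_exp_ofReal_mul_I, mul_one]
  rw [hc, hℓ, norm_zero] at hn
  exact norm_eq_zero.1 (tendsto_nhds_unique tendsto_const_nhds hn)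

/-- After division by `e^{ikx}` the `fm` part oscillates like `B e^{-2ikx}`, which has a limit only
for `B = 0`. All independence and uniqueness of Jost solutions rests on this. -/
theorem AsympExp.coeff_eq {k : ℝ} (hk : k ≠ 0) {fp fm : ℝ → ℂ} (hp : AsympExp k fp)
    (hm : AsympExp (-k) fm) {A B c : ℂ}
    (h : Tendsto (fun x : ℝ => (A * fp x + B * fm x) / exp (I * k * x)) atTop (𝓝 c)) :
    A = c ∧ B = 0 := by
  have e : ∀ x : ℝ, ‖exp (I * (-2 * k : ℝ) * x)‖ = 1 := fun x => by
    rw [show I * (-2 * k : ℝ) * x = ((-2 * k * x : ℝ) : ℂ) * I by push_cast; ring,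
      Complex.norm_exp_ofReal_mul_I]
  -- The error of replacing `fm` by its exponential tends to zero; the remaining phase has modulus
  -- one.
  have h₁ : Tendsto (fun x : ℝ => B * (fm x / exp (I * (-k : ℝ) * x) - 1) *
      exp (I * (-2 * k : ℝ) * x)) atTop (𝓝 0) := by
    have := (tendsto_const_nhds (x := B)).mul (hm.sub_const 1)
    rw [sub_self, mul_zero] at this
    rw [tendsto_zero_iff_norm_tendsto_zero] at this ⊢
    refine this.congr fun x => ?_
    rw [norm_mul _ (exp _), e, mul_one]
  have h₂ : Tendsto (fun x : ℝ => B * exp (I * (-2 * k : ℝ) * x)) atTop (𝓝 (c - A * 1 - 0)) := by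
    refine ((h.sub (hp.const_mul A)).sub h₁).congr fun x => ?_
    have e₁ : exp (I * (-2 * k : ℝ) * x) = exp (I * (-k : ℝ) * x) / exp (I * k * x) := by
      rw [← Complex.exp_sub]
      congr 1
      push_cast
      ring
    rw [e₁]
    field_simp [Complex.exp_ne_zero]
    ring
  have hB := eq_zero_of_tendsto_mul_exp (mul_ne_zero (by norm_num) hk) h₂
  refine ⟨?_, hB⟩
  simp only [hB, zero_mul] at h₂
  have := tendsto_nhds_unique tendsto_const_nhds h₂
  linear_combination this

theorem AsympExp.coeff_eq_of_asympExp {k : ℝ} (hk : k ≠ 0) {fp fm f : ℝ → ℂ}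
    (hp : AsympExp k fp) (hm : AsympExp (-k) fm) (hf : AsympExp k f) {A B : ℂ} {a : ℝ}
    (h : ∀ x, a ≤ x → f x = A * fp x + B * fm x) : A = 1 ∧ B = 0 := by
  refine hp.coeff_eq hk hm (hf.congr' ?_)
  filter_upwards [eventually_ge_atTop a] with x hx
  rw [h x hx]

theorem asympExp_exp (κ : ℝ) : AsympExp κ fun x => exp (I * κ * x) :=
  tendsto_const_nhds.congr fun _ => (div_self (Complex.exp_ne_zero _)).symm

theorem isSolPair_exp (κ : ℝ) (s : Set ℝ) :
    IsSolPair (fun _ => 0) (κ ^ 2) s (fun x => exp (I * κ * x))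
      (fun x => I * κ * exp (I * κ * x)) := by
  intro x _
  have h : HasDerivWithinAt (fun x : ℝ => exp (I * κ * x)) (I * κ * exp (I * κ * x)) s x := by
    have : HasDerivAt (fun x : ℝ => I * κ * (x : ℂ)) (I * κ) x := by
      simpa using (Complex.ofRealCLM.hasDerivAt (x := x)).const_mul (I * (κ : ℂ))
    simpa [mul_comm] using this.cexp.hasDerivWithinAt
  refine ⟨h, (h.const_mul (I * (κ : ℂ))).congr_deriv ?_⟩
  push_cast
  linear_combination (κ : ℂ) ^ 2 * exp (I * κ * x) * Complex.I_sq

theorem IsSolPair.linearCombination {q : ℝ → ℝ} {lam : ℝ} {s : Set ℝ} {f₁ g₁ f₂ g₂ : ℝ → ℂ}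
    (h₁ : IsSolPair q lam s f₁ g₁) (h₂ : IsSolPair q lam s f₂ g₂) (A B : ℂ) :
    IsSolPair q lam s (fun x => A * f₁ x + B * f₂ x) (fun x => A * g₁ x + B * g₂ x) := by
  intro x hx
  refine ⟨((h₁ x hx).1.const_mul A).add ((h₂ x hx).1.const_mul B),
    (((h₁ x hx).2.const_mul A).add ((h₂ x hx).2.const_mul B)).congr_deriv ?_⟩
  ring

/-- Where the potential vanishes, `f` is a combination of `e^{±ikx}`, and its asymptotics leave only
the first of them with coefficient one. -/
theorem IsSolPair.eq_exp {k : ℝ} (hk : k ≠ 0) {q : ℝ → ℝ} {a : ℝ} {f g : ℝ → ℂ}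
    (hq : ∀ x, a ≤ x → q x = 0) (h : IsSolPair q (k ^ 2) (Ici a) f g) (hf : AsympExp k f) :
    f a = exp (I * k * a) ∧ g a = I * k * exp (I * k * a) := by
  have h₀ : IsSolPair (fun _ => 0) (k ^ 2) (Ici a) f g :=
    h.congr (fun x hx => (hq x hx).symm) (fun _ _ => rfl) fun _ _ => rfl
  have hp := isSolPair_exp k (Ici a)
  have hm := isSolPair_exp (-k) (Ici a)
  rw [neg_sq] at hm
  have hIk : (I * k : ℂ) ≠ 0 := mul_ne_zero Complex.I_ne_zero (by exact_mod_cast hk)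
  have hep := Complex.exp_ne_zero (I * k * a)
  have hem := Complex.exp_ne_zero (I * (-k : ℝ) * a)
  -- `A` and `B` are the coefficients that reproduce the value and the derivative of `f` at `a`.
  set A : ℂ := (f a + g a / (I * k)) / 2 / exp (I * k * a) with hA
  set B : ℂ := (f a - g a / (I * k)) / 2 / exp (I * (-k : ℝ) * a) with hB
  have hAe : A * exp (I * k * a) = (f a + g a / (I * k)) / 2 := div_mul_cancel₀ _ hep
  have hBe : B * exp (I * (-k : ℝ) * a) = (f a - g a / (I * k)) / 2 := div_mul_cancel₀ _ hem
  have hg : g a / (I * k) * (I * k) = g a := div_mul_cancel₀ _ hIk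
  have hu : ∀ x, a ≤ x → f x = A * exp (I * k * x) + B * exp (I * (-k : ℝ) * x) := by
    intro x hx
    refine (h₀.unique ordConnected_Ici continuousOn_const (hp.linearCombination hm A B)
      self_mem_Ici ?_ ?_ hx).1
    · linear_combination -hAe - hBe
    · push_cast at hBe ⊢
      linear_combination -(I * k) * hAe + (I * k) * hBe - hg
  obtain ⟨hA1, hB0⟩ := (asympExp_exp k).coeff_eq_of_asympExp hk (asympExp_exp (-k)) hf hu
  rw [hA1] at hAe
  rw [hB0] at hBe
  refine ⟨by linear_combination -hAe - hBe, ?_⟩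
  · linear_combination -(I * k) * hAe + (I * k) * hBe - hg

/-- The energy is a separate variable so that the result applies to `-k` in the same solution space.
-/
theorem cauchyData_eq_exp {k lam : ℝ} (hk : k ≠ 0) (hlam : lam = k ^ 2) {q : ℝ → ℝ} {a : ℝ}
    (ha : 0 ≤ a) (hq : ∀ x, a ≤ x → q x = 0) (f : solSpace q lam (Ici 0))
    (hf : AsympExp k f.1) :
    cauchyData q lam (Ici 0) a ha f = (exp (I * k * a), I * k * exp (I * k * a)) := by
  subst hlam
  have h := ((solSpace_isSolPair (uniqueDiffOn_Ici 0) f).mono (Ici_subset_Ici.2 ha)).eq_exp hk hq hf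
  exact Prod.ext h.1 h.2

/-- The solution with given coefficients with respect to a pair of solutions. -/
def solComb {q : ℝ → ℝ} {lam : ℝ} {s : Set ℝ} (fp fm : solSpace q lam s) :
    ℂ × ℂ →ₗ[ℂ] solSpace q lam s :=
  (LinearMap.toSpanSingleton ℂ _ fp).coprod (LinearMap.toSpanSingleton ℂ _ fm)

theorem solComb_apply {q : ℝ → ℝ} {lam : ℝ} {s : Set ℝ} (fp fm : solSpace q lam s) (c : ℂ × ℂ) :
    solComb fp fm c = c.1 • fp + c.2 • fm := by
  simp [solComb]

theorem solComb_injective {k : ℝ} (hk : k ≠ 0) {q : ℝ → ℝ} {lam : ℝ} {s : Set ℝ}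
    {fp fm : solSpace q lam s} (hp : AsympExp k fp.1) (hm : AsympExp (-k) fm.1) :
    Function.Injective (solComb fp fm) := by
  rw [← LinearMap.ker_eq_bot, LinearMap.ker_eq_bot']
  intro c hc
  rw [solComb_apply] at hc
  have h := hp.coeff_eq hk hm (A := c.1) (B := c.2) (c := 0) (by
    refine tendsto_const_nhds.congr fun x => ?_
    have : c.1 * fp.1 x + c.2 * fm.1 x = 0 := congrFun (congrArg Subtype.val hc) x
    rw [this, zero_div])
  exact Prod.ext h.1 h.2

/-- Existence for the initial value problem comes from dimension: the two Jost solutions are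
independent, so the injective map from their coefficients to Cauchy data is an endomorphism of `ℂ ×
ℂ` and is onto. -/
theorem cauchyData_ray_bijective {k : ℝ} (hk : k ≠ 0) {q : ℝ → ℝ} {lam : ℝ} (hq : ContinuousOn q (Ici 0))
    {fp fm : solSpace q lam (Ici 0)} (hp : AsympExp k fp.1) (hm : AsympExp (-k) fm.1)
    {x : ℝ} (hx : x ∈ Ici (0 : ℝ)) :
    Function.Bijective (cauchyData q lam (Ici 0) x hx) := by
  have hi := cauchyData_injective (lam := lam) (uniqueDiffOn_Ici 0) ordConnected_Ici hq hx
  refine ⟨hi, ?_⟩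
  have h : Function.Injective ((cauchyData q lam (Ici 0) x hx).comp (solComb fp fm)) :=
    hi.comp (solComb_injective hk hp hm)
  intro u
  obtain ⟨c, hc⟩ := LinearMap.injective_iff_surjective.1 h u
  exact ⟨_, hc⟩

theorem solComb_bijective {k : ℝ} (hk : k ≠ 0) {q : ℝ → ℝ} {lam : ℝ} (hq : ContinuousOn q (Ici 0))
    {fp fm : solSpace q lam (Ici 0)} (hp : AsympExp k fp.1) (hm : AsympExp (-k) fm.1) :
    Function.Bijective (solComb fp fm) := by
  have hi := cauchyData_injective (lam := lam) (uniqueDiffOn_Ici 0) ordConnected_Ici hq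
    (x := 0) self_mem_Ici
  refine ⟨solComb_injective hk hp hm, fun f => ?_⟩
  have h : Function.Injective ((cauchyData q lam (Ici 0) 0 self_mem_Ici).comp
      (solComb fp fm)) := hi.comp (solComb_injective hk hp hm)
  obtain ⟨c, hc⟩ := LinearMap.injective_iff_surjective.1 h (cauchyData _ _ _ _ _ f)
  exact ⟨c, hi hc⟩

theorem jost_unique {k : ℝ} (hk : k ≠ 0) {q : ℝ → ℝ} {lam : ℝ} (hq : ContinuousOn q (Ici 0))
    {fp fm f : solSpace q lam (Ici 0)} (hp : AsympExp k fp.1) (hm : AsympExp (-k) fm.1)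
    (hf : AsympExp k f.1) : f = fp := by
  obtain ⟨c, rfl⟩ := (solComb_bijective hk hq hp hm).2 f
  rw [solComb_apply] at hf ⊢
  obtain ⟨h₁, h₂⟩ := hp.coeff_eq_of_asympExp hk hm (a := 0) hf fun _ _ => rfl
  rw [h₁, h₂, one_smul, zero_smul, add_zero]

/-! ### Lagrange planes -/

section Symplectic

variable {V : Type*} [AddCommGroup V] [Module ℂ V] {ω : SesqForm V}

theorem SkewHermitian.eq_zero_comm (hω : SkewHermitian ω) {x y : V} :
    ω x y = 0 ↔ ω y x = 0 := by
  rw [hω x y, neg_eq_zero, map_eq_zero (starRingEnd ℂ)]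

theorem le_perp_perp (hω : SkewHermitian ω) (W : Submodule ℂ V) : W ≤ perp ω (perp ω W) :=
  fun _ hw _ hv => hω.eq_zero_comm.1 (hv _ hw)

/-- Surjectivity of `ω` is the form of nondegeneracy used throughout: a functional separating `v`
from `W` is then `ω u` for some `u`, which lies in the complement of `W`. -/
theorem perp_perp (hω : SkewHermitian ω) (hs : Function.Surjective ω) (W : Submodule ℂ V) :
    perp ω (perp ω W) = W := by
  refine le_antisymm (fun v hv => ?_) (le_perp_perp hω W)
  by_contra hvW
  obtain ⟨f, hfv, hf⟩ := Submodule.exists_le_ker_of_notMem hvW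
  obtain ⟨u, rfl⟩ := hs f
  exact hfv (hv u fun w hw => hω.eq_zero_comm.1 (hf hw))

theorem perp_sup (N W : Submodule ℂ V) : perp ω (N ⊔ W) = perp ω N ⊓ perp ω W := by
  ext v
  refine ⟨fun h => ⟨fun n hn => h n (Submodule.mem_sup_left hn),
    fun n hn => h n (Submodule.mem_sup_right hn)⟩, fun h x hx => ?_⟩
  obtain ⟨n, hn, w, hw, rfl⟩ := Submodule.mem_sup.1 hx
  rw [map_add, LinearMap.add_apply, h.1 n hn, h.2 w hw, add_zero]

/-- The complement is the kernel of the pairing with all `w i`. By independence of the `w i` and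
nondegeneracy the pairing is onto, so its kernel has dimension `2n - n = n`, that of the span. -/
theorem isLagrange_span {ι : Type*} [Fintype ι] [FiniteDimensional ℂ V]
    (hω : SkewHermitian ω) (hs : Function.Surjective ω)
    (hd : Module.finrank ℂ V = 2 * Fintype.card ι) {w : ι → V} (hw : LinearIndependent ℂ w)
    (hi : Submodule.span ℂ (range w) ≤ perp ω (Submodule.span ℂ (range w))) :
    IsLagrange ω (Submodule.span ℂ (range w)) := by
  classical
  let T : V →ₗ[ℂ] (ι → ℂ) := LinearMap.pi fun i => ω (w i)
  have hTs : LinearMap.range T = ⊤ := by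
    by_contra hne
    obtain ⟨f, hf0, hf⟩ := Submodule.exists_le_ker_of_lt_top _ (lt_top_iff_ne_top.2 hne)
    have hfe : ∀ x : ι → ℂ, f x = ∑ i, x i * f (Pi.single i 1) := fun x => by
      conv_lhs => rw [pi_eq_sum_univ' x]
      simp [map_sum]
    -- A functional vanishing on the range of `T` gives a vector in the radical of `ω`; the
    -- coefficients are conjugated because `ω` is conjugate-linear in its first argument.
    have hu : ∑ i, conj (f (Pi.single i 1)) • w i = 0 := by
      obtain ⟨g, hg⟩ : ∃ u : V, u = ∑ i, conj (f (Pi.single i 1)) • w i := ⟨_, rfl⟩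
      rw [← hg]
      by_contra hg0
      have hz : ∀ v, ω g v = 0 := fun v => by
        have : f (T v) = 0 := hf ⟨v, rfl⟩
        rw [hfe] at this
        rw [hg, map_sum, LinearMap.sum_apply, ← this]
        refine Finset.sum_congr rfl fun i _ => ?_
        simp [T, mul_comm]
      have hnot : g ∉ (⊥ : Submodule ℂ V) := by simpa using hg0
      refine hnot ?_
      rw [← perp_perp hω hs ⊥]
      exact fun v _ => hω.eq_zero_comm.1 (hz v)
    have h0 := Fintype.linearIndependent_iff.1 hw _ hu
    refine hf0 (LinearMap.ext fun x => ?_)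
    rw [hfe]
    exact Finset.sum_eq_zero fun i _ => by rw [(map_eq_zero _).1 (h0 i), mul_zero]
  have hker : perp ω (Submodule.span ℂ (range w)) = LinearMap.ker T := by
    ext v
    refine ⟨fun h => funext fun i => h _ (Submodule.subset_span ⟨i, rfl⟩), fun h x hx => ?_⟩
    refine hω.eq_zero_comm.1 ?_
    refine (Submodule.span_le.2 ?_ : _ ≤ LinearMap.ker (ω v)) hx
    rintro _ ⟨i, rfl⟩
    exact hω.eq_zero_comm.1 (congrFun (LinearMap.mem_ker.1 h) i)
  have h1 := T.finrank_range_add_finrank_ker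
  rw [hTs, finrank_top, Module.finrank_fintype_fun_eq_card, ← hker, hd] at h1
  refine (Submodule.eq_of_le_of_finrank_eq hi ?_).symm
  rw [finrank_span_eq_card hw]
  omega

/-- A vector of `N^⊥` orthogonal to `W ∩ N^⊥ = (W + N)^⊥` lies in `W + N`. Its `W` component is
again in `N^⊥`, since `N` is isotropic, and represents the same class. -/
theorem reducedPlane_isLagrange (hω : SkewHermitian ω) (hs : Function.Surjective ω)
    {N W : Submodule ℂ V} (hN : N ≤ perp ω N) (hW : IsLagrange ω W) :
    IsLagrange (reducedForm ω hω N) (reducedPlane ω N W) := by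
  apply le_antisymm
  · intro x hx
    obtain ⟨x, rfl⟩ := Submodule.Quotient.mk_surjective _ x
    have hx' : x.1 ∈ W ⊔ N := by
      rw [← perp_perp hω hs (W ⊔ N), perp_sup, show perp ω W = W from hW]
      intro l hl
      exact hx (Submodule.Quotient.mk ⟨l, hl.2⟩)
        (Submodule.mem_map_of_mem (f := (N.submoduleOf (perp ω N)).mkQ)
          (show (⟨l, hl.2⟩ : perp ω N) ∈ W.submoduleOf (perp ω N) from hl.1))
    obtain ⟨l, hl, n, hn, hln⟩ := Submodule.mem_sup.1 hx'
    have hlN : l ∈ perp ω N := by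
      rw [eq_sub_of_add_eq hln]
      exact sub_mem x.2 (hN hn)
    refine ⟨⟨l, hlN⟩, hl, (Submodule.Quotient.eq _).2 ?_⟩
    change l - x.1 ∈ N
    rw [← hln, sub_add_cancel_left]
    exact neg_mem hn
  · rintro _ ⟨x, hx, rfl⟩ _ ⟨y, hy, rfl⟩
    have hx' : x.1 ∈ perp ω W := by
      rw [show perp ω W = W from hW]
      exact hx
    exact hx' y.1 hy

/-- The map on `N^⊥ / N` induced by a linear map that vanishes on `N`. -/
def reducedLift {U : Type*} [AddCommGroup U] [Module ℂ U] (ω : SesqForm V) (N : Submodule ℂ V)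
    (f : V →ₗ[ℂ] U) (hf : N ≤ LinearMap.ker f) : Reduced ω N →ₗ[ℂ] U :=
  (N.submoduleOf (perp ω N)).liftQ (f.comp (perp ω N).subtype) fun _ hx => hf hx

theorem reducedLift_bijective {U : Type*} [AddCommGroup U] [Module ℂ U] {N : Submodule ℂ V}
    {f : V →ₗ[ℂ] U} (hf : N ≤ LinearMap.ker f) (hk : perp ω N ⊓ LinearMap.ker f ≤ N)
    (hs : ∀ u, ∃ v ∈ perp ω N, f v = u) : Function.Bijective (reducedLift ω N f hf) := by
  refine ⟨?_, fun u => ?_⟩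
  · rw [← LinearMap.ker_eq_bot, LinearMap.ker_eq_bot']
    intro x hx
    obtain ⟨x, rfl⟩ := Submodule.Quotient.mk_surjective _ x
    exact (Submodule.Quotient.mk_eq_zero _).2 (hk ⟨x.2, hx⟩)
  · obtain ⟨v, hv, rfl⟩ := hs u
    exact ⟨Submodule.Quotient.mk ⟨v, hv⟩, rfl⟩

theorem form_reducedLift {U : Type*} [AddCommGroup U] [Module ℂ U] (hω : SkewHermitian ω)
    {N : Submodule ℂ V} {f : V →ₗ[ℂ] U} (hf : N ≤ LinearMap.ker f) {ω' : SesqForm U}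
    (h : ∀ x ∈ perp ω N, ∀ y ∈ perp ω N, ω' (f x) (f y) = ω x y) (x y : Reduced ω N) :
    ω' (reducedLift ω N f hf x) (reducedLift ω N f hf y) = reducedForm ω hω N x y := by
  obtain ⟨x, rfl⟩ := Submodule.Quotient.mk_surjective _ x
  obtain ⟨y, rfl⟩ := Submodule.Quotient.mk_surjective _ y
  exact h _ x.2 _ y.2

theorem map_reducedLift_reducedPlane {U : Type*} [AddCommGroup U] [Module ℂ U]
    {N : Submodule ℂ V} {f : V →ₗ[ℂ] U} (hf : N ≤ LinearMap.ker f) (W : Submodule ℂ V) :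
    (reducedPlane ω N W).map (reducedLift ω N f hf) = (W ⊓ perp ω N).map f := by
  ext u
  constructor
  · rintro ⟨_, ⟨v, hv, rfl⟩, rfl⟩
    exact ⟨v.1, ⟨hv, v.2⟩, rfl⟩
  · rintro ⟨v, ⟨hv, hv'⟩, rfl⟩
    exact ⟨_, ⟨⟨v, hv'⟩, hv, rfl⟩, rfl⟩

end Symplectic

theorem dataForm_surjective (ι : Type*) [Fintype ι] : Function.Surjective (dataForm ι) := by
  classical
  intro f
  -- The components are read off by evaluating the functional on unit values and unit derivatives.
  refine ⟨fun i => (conj (f (Pi.single i (0, 1))), -conj (f (Pi.single i (1, 0)))), ?_⟩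
  refine LinearMap.ext fun v => ?_
  have hv : v = ∑ i, ((v i).1 • (Pi.single i (1, 0) : ι → ℂ × ℂ) +
      (v i).2 • (Pi.single i (0, 1) : ι → ℂ × ℂ)) := by
    funext j
    simp [Finset.sum_apply, Pi.single_apply, Finset.sum_add_distrib]
  conv_rhs => rw [hv]
  rw [dataForm_apply, map_sum]
  refine Finset.sum_congr rfl fun i _ => ?_
  simp
  ring

theorem pullForm_surjective {U V : Type*} [AddCommGroup U] [Module ℂ U] [AddCommGroup V]
    [Module ℂ V] {ω : SesqForm V} (hs : Function.Surjective ω) (e : U ≃ₗ[ℂ] V) :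
    Function.Surjective (pullForm ω e.toLinearMap) := by
  intro f
  obtain ⟨v, hv⟩ := hs (f.comp e.symm.toLinearMap)
  refine ⟨e.symm v, ?_⟩
  ext x
  change ω (e (e.symm v)) (e x) = f x
  rw [e.apply_symm_apply, hv]
  simp

/-! ### Eigenplanes are Lagrange planes -/

namespace SchrodingerGraph

variable {R E : Type*} [Fintype R] [Fintype E] (G : SchrodingerGraph R E) {k : ℝ}

/-- Families of Jost solutions on the rays. -/
def IsJost (k : ℝ) (fp fm : G.AsympSpace k) : Prop :=
  (∀ r, AsympExp k (fp r).1) ∧ ∀ r, AsympExp (-k) (fm r).1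

variable {G} {fp fm : G.AsympSpace k}

theorem IsJost.cauchyData_bijective (hJ : G.IsJost k fp fm) (hk : k ≠ 0) (r : R) {x : ℝ}
    (hx : x ∈ Ici (0 : ℝ)) :
    Function.Bijective (cauchyData (G.rayPot r) (k ^ 2) (Ici 0) x hx) :=
  cauchyData_ray_bijective hk (G.rayPot_cont r) (hJ.1 r) (hJ.2 r) hx

theorem IsJost.rayData_bijective (hJ : G.IsJost k fp fm) (hk : k ≠ 0) :
    Function.Bijective (G.rayData k) := by
  refine ⟨fun φ ψ h => funext fun r => (hJ.cauchyData_bijective hk r self_mem_Ici).1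
    (congrFun h r), fun u => ?_⟩
  choose φ hφ using fun r => (hJ.cauchyData_bijective hk r self_mem_Ici).2 (u r)
  exact ⟨φ, funext hφ⟩

/-- Cauchy data at the origins of the rays as coordinates on the asymptotic space. -/
def IsJost.rayDataEquiv (hJ : G.IsJost k fp fm) (hk : k ≠ 0) :
    G.AsympSpace k ≃ₗ[ℂ] (R → ℂ × ℂ) :=
  LinearEquiv.ofBijective (G.rayData k) (hJ.rayData_bijective hk)

theorem IsJost.finiteDimensional (hJ : G.IsJost k fp fm) (hk : k ≠ 0) :
    FiniteDimensional ℂ (G.AsympSpace k) :=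
  (hJ.rayDataEquiv hk).symm.finiteDimensional

theorem IsJost.finrank_eq (hJ : G.IsJost k fp fm) (hk : k ≠ 0) :
    Module.finrank ℂ (G.AsympSpace k) = 2 * Fintype.card R := by
  rw [(hJ.rayDataEquiv hk).finrank_eq, Module.finrank_pi_fintype]
  simp [mul_comm]

theorem IsJost.asympForm_surjective (hJ : G.IsJost k fp fm) (hk : k ≠ 0) :
    Function.Surjective (G.asympForm k) := by
  intro f
  obtain ⟨u, hu⟩ := pullForm_surjective (dataForm_surjective R) (hJ.rayDataEquiv hk) ((k : ℂ) • f)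
  refine ⟨u, ?_⟩
  change (k : ℂ)⁻¹ • pullForm (dataForm R) (hJ.rayDataEquiv hk).toLinearMap u = f
  rw [hu, smul_smul, inv_mul_cancel₀ (by exact_mod_cast hk), one_smul]

/-- Green's formula: the two ends of an interior edge contribute the same Wronskian with opposite
signs, as the derivatives point into the edge. -/
theorem dataForm_boundaryValues (φ ψ : G.AsympSpace k × G.EdgeSpace k) :
    dataForm _ (G.boundaryValues k φ) (G.boundaryValues k ψ) =
      dataForm R (G.rayData k φ.1) (G.rayData k ψ.1) := by
  simp only [dataForm_eq_sum]
  rw [Fintype.sum_sum_type, Fintype.sum_sum_type, ← Finset.sum_add_distrib]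
  refine (congrArg (_ + ·) (Finset.sum_eq_zero fun e _ => ?_)).trans (add_zero _)
  have h := cauchyData_wronskian_eq (uniqueDiffOn_Icc (G.len_pos e)) (convex_Icc 0 (G.len e))
      (φ.2 e) (ψ.2 e) (left_mem_Icc.2 (G.len_pos e).le) (right_mem_Icc.2 (G.len_pos e).le)
  exact (congrArg₂ (· + ·) h (dataWronskian_flip _ _)).trans (add_neg_cancel _)

theorem eigenplane_isotropic (G : SchrodingerGraph R E) (k : ℝ) :
    G.eigenplane k ≤ perp (G.asympForm k) (G.eigenplane k) := by
  rintro _ ⟨ψ, hψ, rfl⟩ _ ⟨φ, hφ, rfl⟩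
  have h : G.boundaryValues k ψ ∈ perp (dataForm _) G.bc := by
    rw [show perp _ G.bc = G.bc from G.bc_lagrange]
    exact hψ
  have h' := h _ hφ
  rw [dataForm_boundaryValues] at h'
  change (k : ℂ)⁻¹ * dataForm R (G.rayData k φ.1) (G.rayData k ψ.1) = 0
  rw [h', mul_zero]

/-- Isotropy is automatic; the scattering waves supply the missing half dimension, one independent
element per ray in a space of dimension twice the number of rays. -/
theorem IsScatteringMatrix.isLagrange_eigenplane [DecidableEq R] {S : Matrix R R ℂ}
    (hS : G.IsScatteringMatrix k S) (hk : k ≠ 0) : IsLagrange (G.asympForm k) (G.eigenplane k) := by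
  obtain ⟨fp, fm, hp, hm, hi, hs⟩ := hS
  have hJ : G.IsJost k fp fm := ⟨hp, hm⟩
  have := hJ.finiteDimensional hk
  have h := G.eigenplane_isotropic k
  rw [← hs] at h ⊢
  exact isLagrange_span (G.asympForm_skew k) (hJ.asympForm_surjective hk) (hJ.finrank_eq hk) hi h

end SchrodingerGraph

/-! ### Joining solutions end to end -/

section Join

variable {q₁ q₂ : ℝ → ℝ} {lam a b : ℝ}

theorem joinPot_eqOn_left : EqOn (joinPot q₁ q₂ a b) q₁ (Icc 0 a) :=
  fun _ hx => if_pos hx.2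

theorem joinPot_eqOn_right (h₁ : q₁ a = 0) (h₂ : q₂ b = 0) :
    EqOn (joinPot q₁ q₂ a b) (fun x => q₂ (a + b - x)) (Icc a (a + b)) := by
  intro x hx
  -- At the joint itself `joinPot` takes the value of `q₁`, so both potentials must vanish at their
  -- cut points.
  rcases hx.1.eq_or_lt with rfl | h
  · simp [joinPot, h₁, h₂]
  · exact if_neg (not_le.2 h)

/-- The edge and ray solutions obey the same equation on `[0, a]`, so agreement at the cut
propagates back to the origin. -/
theorem cauchyData_zero_eq_of_join (ha : 0 ≤ a) (hb : 0 ≤ b) (hab : 0 < a + b)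
    (hq₁ : ContinuousOn q₁ (Ici 0))
    (f : solSpace (joinPot q₁ q₂ a b) lam (Icc 0 (a + b))) (f₁ : solSpace q₁ lam (Ici 0))
    (h : cauchyData q₁ lam (Ici 0) a ha f₁ =
      cauchyData _ lam (Icc 0 (a + b)) a ⟨ha, le_add_of_nonneg_right hb⟩ f) :
    cauchyData q₁ lam (Ici 0) 0 self_mem_Ici f₁ =
      cauchyData _ lam (Icc 0 (a + b)) 0 (left_mem_Icc.2 hab.le) f := by
  have hf := ((solSpace_isSolPair (uniqueDiffOn_Icc hab) f).mono
    (Icc_subset_Icc_right (le_add_of_nonneg_right hb))).congr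
    joinPot_eqOn_left.symm (fun _ _ => rfl) fun _ _ => rfl
  have hf₁ := (solSpace_isSolPair (uniqueDiffOn_Ici 0) f₁).mono (Icc_subset_Ici_self : Icc 0 a ⊆ _)
  have := hf₁.unique ordConnected_Icc (hq₁.mono Icc_subset_Ici_self) hf (right_mem_Icc.2 ha)
    (congrArg Prod.fst h) (congrArg Prod.snd h) (left_mem_Icc.2 ha)
  exact Prod.ext this.1 this.2

theorem cauchyData_zero_eq_flip_of_join (ha : 0 ≤ a) (hb : 0 ≤ b) (hab : 0 < a + b)
    (hq₂ : ContinuousOn q₂ (Ici 0)) (h₁ : q₁ a = 0) (h₂ : q₂ b = 0)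
    (f : solSpace (joinPot q₁ q₂ a b) lam (Icc 0 (a + b))) (f₂ : solSpace q₂ lam (Ici 0))
    (h : cauchyData q₂ lam (Ici 0) b hb f₂ = flipData
      (cauchyData _ lam (Icc 0 (a + b)) a ⟨ha, le_add_of_nonneg_right hb⟩ f)) :
    cauchyData q₂ lam (Ici 0) 0 self_mem_Ici f₂ = flipData
      (cauchyData _ lam (Icc 0 (a + b)) (a + b) (right_mem_Icc.2 hab.le) f) := by
  have hmaps : MapsTo (fun x => a + b - x) (Icc 0 b) (Icc a (a + b)) := fun x hx =>
    ⟨by linarith [hx.2], by linarith [hx.1]⟩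
  have hf := (((solSpace_isSolPair (uniqueDiffOn_Icc hab) f).mono
    (Icc_subset_Icc_left ha)).reflect (a + b) hmaps).congr (q' := q₂)
    (fun _ hx => ((joinPot_eqOn_right h₁ h₂ (hmaps hx)).trans
      (congrArg q₂ (sub_sub_cancel _ _))).symm)
    (fun _ _ => rfl) fun _ _ => rfl
  have hf₂ := (solSpace_isSolPair (uniqueDiffOn_Ici 0) f₂).mono (Icc_subset_Ici_self : Icc 0 b ⊆ _)
  have := hf₂.unique ordConnected_Icc (hq₂.mono Icc_subset_Ici_self) hf (right_mem_Icc.2 hb)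
    (by simpa using! congrArg Prod.fst h) (by simpa using! congrArg Prod.snd h)
    (left_mem_Icc.2 hb)
  rw [sub_zero] at this
  exact Prod.ext this.1 this.2

theorem exists_join (ha : 0 ≤ a) (hb : 0 ≤ b) (hab : 0 < a + b)
    (h₁ : q₁ a = 0) (h₂ : q₂ b = 0) (f₁ : solSpace q₁ lam (Ici 0)) (f₂ : solSpace q₂ lam (Ici 0))
    (h : cauchyData q₁ lam (Ici 0) a ha f₁ = flipData (cauchyData q₂ lam (Ici 0) b hb f₂)) :
    ∃ f : solSpace (joinPot q₁ q₂ a b) lam (Icc 0 (a + b)),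
      cauchyData _ lam (Icc 0 (a + b)) 0 (left_mem_Icc.2 hab.le) f =
        cauchyData q₁ lam (Ici 0) 0 self_mem_Ici f₁ ∧
      flipData (cauchyData _ lam (Icc 0 (a + b)) (a + b) (right_mem_Icc.2 hab.le) f) =
        cauchyData q₂ lam (Ici 0) 0 self_mem_Ici f₂ := by
  set g₁ := derivWithin f₁.1 (Ici 0) with hg₁
  set g₂ := derivWithin f₂.1 (Ici 0) with hg₂
  have hv : f₁.1 a = f₂.1 b := congrArg Prod.fst h
  have hd : g₁ a = -g₂ b := congrArg Prod.snd h
  have hmaps : MapsTo (fun x => a + b - x) (Icc a (a + b)) (Ici 0) := fun x hx =>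
    sub_nonneg.2 hx.2
  -- The second solution is run backwards, which is why its derivative enters with a minus sign and
  -- why the pieces agree at `a` exactly when the data match.
  let F : ℝ → ℂ := fun x => if x ≤ a then f₁.1 x else f₂.1 (a + b - x)
  let F' : ℝ → ℂ := fun x => if x ≤ a then g₁ x else -g₂ (a + b - x)
  have hl : IsSolPair (joinPot q₁ q₂ a b) lam (Icc 0 a) F F' :=
    ((solSpace_isSolPair (uniqueDiffOn_Ici 0) f₁).mono Icc_subset_Ici_self).congr
      joinPot_eqOn_left (fun _ hx => if_pos hx.2) fun _ hx => if_pos hx.2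
  have hFr : EqOn F (fun x => f₂.1 (a + b - x)) (Icc a (a + b)) := by
    intro x hx
    rcases hx.1.eq_or_lt with rfl | hlt
    · simp [F, hv]
    · exact if_neg (not_le.2 hlt)
  have hFr' : EqOn F' (fun x => -g₂ (a + b - x)) (Icc a (a + b)) := by
    intro x hx
    rcases hx.1.eq_or_lt with rfl | hlt
    · simp [F', hd]
    · exact if_neg (not_le.2 hlt)
  have hr : IsSolPair (joinPot q₁ q₂ a b) lam (Icc a (a + b)) F F' :=
    ((solSpace_isSolPair (uniqueDiffOn_Ici 0) f₂).reflect (a + b) hmaps).congr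
      (joinPot_eqOn_right h₁ h₂) hFr hFr'
  have hF := hl.union hr isClosed_Icc isClosed_Icc
  rw [Icc_union_Icc_eq_Icc ha (le_add_of_nonneg_right hb)] at hF
  refine ⟨hF.toSolSpace, ?_, ?_⟩
  · rw [hF.cauchyData_toSolSpace (uniqueDiffOn_Icc hab)]
    exact Prod.ext (if_pos ha) (if_pos ha)
  · rw [hF.cauchyData_toSolSpace (uniqueDiffOn_Icc hab),
      hFr (right_mem_Icc.2 (le_add_of_nonneg_right hb)),
      hFr' (right_mem_Icc.2 (le_add_of_nonneg_right hb))]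
    simp only [sub_self]
    exact Prod.ext rfl (neg_neg _)

end Join

/-! ### Reduction of the sum space by `N` -/

namespace Linking

variable {P N₁ N₂ E₁ E₂ : Type*} [Fintype P] [Fintype N₁] [Fintype N₂] [Fintype E₁]
  [Fintype E₂] {G₁ : SchrodingerGraph (P ⊕ N₁) E₁} {G₂ : SchrodingerGraph (P ⊕ N₂) E₂}
  (L : Linking G₁ G₂) {k : ℝ}

theorem mem_matching {ψ : L.SumSpace k} :
    ψ ∈ L.matching k ↔ ∀ i, L.cutData₁ k i ψ = flipData (L.cutData₂ k i ψ) := by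
  simp [matching, Submodule.mem_iInf]

theorem linkSpace_le_ker : L.linkSpace k ≤ LinearMap.ker (L.restrict k) :=
  inf_le_right

/-- The Wronskians on the linking rays are moved from the origins to the cuts; on the other rays
they make up the form of the linked graph. -/
theorem sumForm_eq (φ ψ : L.SumSpace k) :
    L.sumForm k φ ψ = (k : ℂ)⁻¹ * ∑ i, (dataWronskian (L.cutData₁ k i φ) (L.cutData₁ k i ψ) +
      dataWronskian (L.cutData₂ k i φ) (L.cutData₂ k i ψ)) +
        L.linked.asympForm k (L.restrict k φ) (L.restrict k ψ) := by
  have h₁ : ∀ i, dataWronskian (L.cutData₁ k i φ) (L.cutData₁ k i ψ) =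
      dataWronskian (G₁.rayData k φ.1 (.inl i)) (G₁.rayData k ψ.1 (.inl i)) := fun i =>
    cauchyData_wronskian_eq (uniqueDiffOn_Ici 0) (convex_Ici 0) _ _ (L.a₁_nonneg i) self_mem_Ici
  have h₂ : ∀ i, dataWronskian (L.cutData₂ k i φ) (L.cutData₂ k i ψ) =
      dataWronskian (G₂.rayData k φ.2 (.inl i)) (G₂.rayData k ψ.2 (.inl i)) := fun i =>
    cauchyData_wronskian_eq (uniqueDiffOn_Ici 0) (convex_Ici 0) _ _ (L.a₂_nonneg i) self_mem_Ici
  change (k : ℂ)⁻¹ * ∑ r, dataWronskian (G₁.rayData k φ.1 r) (G₁.rayData k ψ.1 r) +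
    (k : ℂ)⁻¹ * ∑ r, dataWronskian (G₂.rayData k φ.2 r) (G₂.rayData k ψ.2 r) =
      _ + (k : ℂ)⁻¹ * ∑ r, dataWronskian (L.linked.rayData k (L.restrict k φ) r)
        (L.linked.rayData k (L.restrict k ψ) r)
  have h₃ : ∑ r, dataWronskian (L.linked.rayData k (L.restrict k φ) r)
        (L.linked.rayData k (L.restrict k ψ) r) =
      ∑ j, dataWronskian (G₂.rayData k φ.2 (.inr j)) (G₂.rayData k ψ.2 (.inr j)) +
        ∑ j, dataWronskian (G₁.rayData k φ.1 (.inr j)) (G₁.rayData k ψ.1 (.inr j)) :=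
    Fintype.sum_sum_type _
  rw [h₃, Fintype.sum_sum_type, Fintype.sum_sum_type, Finset.sum_add_distrib]
  simp only [h₁, h₂]
  ring

theorem sumForm_surjective (h₁ : Function.Surjective (G₁.asympForm k))
    (h₂ : Function.Surjective (G₂.asympForm k)) : Function.Surjective (L.sumForm k) := by
  intro f
  obtain ⟨u₁, hu₁⟩ := h₁ (f.comp (LinearMap.inl ℂ _ _))
  obtain ⟨u₂, hu₂⟩ := h₂ (f.comp (LinearMap.inr ℂ _ _))
  refine ⟨(u₁, u₂), LinearMap.ext fun v => ?_⟩
  rw [sumForm_apply, hu₁, hu₂, LinearMap.comp_apply, LinearMap.comp_apply, ← map_add]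
  simp

theorem sumPlane_isLagrange (h₁ : IsLagrange (G₁.asympForm k) (G₁.eigenplane k))
    (h₂ : IsLagrange (G₂.asympForm k) (G₂.eigenplane k)) :
    IsLagrange (L.sumForm k) (L.sumPlane k) := by
  apply le_antisymm
  · intro v hv
    refine ⟨?_, ?_⟩
    · rw [← show perp _ (G₁.eigenplane k) = _ from h₁]
      intro w hw
      have h := hv (w, 0) ⟨hw, zero_mem _⟩
      rwa [sumForm_apply, map_zero, LinearMap.zero_apply, add_zero] at h
    · rw [← show perp _ (G₂.eigenplane k) = _ from h₂]
      intro w hw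
      have h := hv (0, w) ⟨zero_mem _, hw⟩
      rwa [sumForm_apply, map_zero, LinearMap.zero_apply, zero_add] at h
  · rintro v ⟨hv₁, hv₂⟩ w ⟨hw₁, hw₂⟩
    rw [← show perp _ (G₁.eigenplane k) = _ from h₁] at hv₁
    rw [← show perp _ (G₂.eigenplane k) = _ from h₂] at hv₂
    rw [sumForm_apply, hv₁ _ hw₁, hv₂ _ hw₂, add_zero]

section Jost

variable {L} {fp₁ fm₁ : G₁.AsympSpace k} {fp₂ fm₂ : G₂.AsympSpace k}

/-- The asymptotic space carries no boundary conditions, so the rays are independent of each other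
and each accepts arbitrary Cauchy data at its cut. -/
theorem exists_sumSpace (hk : k ≠ 0) (h₁ : G₁.IsJost k fp₁ fm₁) (h₂ : G₂.IsJost k fp₂ fm₂)
    (u₁ u₂ : P → ℂ × ℂ) (χ : L.linked.AsympSpace k) :
    ∃ ψ : L.SumSpace k, (∀ i, L.cutData₁ k i ψ = u₁ i) ∧ (∀ i, L.cutData₂ k i ψ = u₂ i) ∧
      L.restrict k ψ = χ := by
  choose φ₁ hφ₁ using fun i =>
    (h₁.cauchyData_bijective hk (.inl i) (L.a₁_nonneg i)).2 (u₁ i)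
  choose φ₂ hφ₂ using fun i =>
    (h₂.cauchyData_bijective hk (.inl i) (L.a₂_nonneg i)).2 (u₂ i)
  refine ⟨(fun r => match r with
    | .inl i => φ₁ i
    | .inr j => χ (.inr j), fun r => match r with
    | .inl i => φ₂ i
    | .inr j => χ (.inl j)), hφ₁, hφ₂, ?_⟩
  funext r
  rcases r with j | j <;> rfl

theorem sumForm_eq_of_matching {φ ψ : L.SumSpace k} (hφ : φ ∈ L.matching k)
    (hψ : ψ ∈ L.matching k) :
    L.sumForm k φ ψ = L.linked.asympForm k (L.restrict k φ) (L.restrict k ψ) := by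
  rw [sumForm_eq, Finset.sum_eq_zero, mul_zero, zero_add]
  intro i _
  rw [L.mem_matching.1 hφ i, L.mem_matching.1 hψ i, dataWronskian_flip, neg_add_cancel]

theorem matching_le_perp : L.matching k ≤ perp (L.sumForm k) (L.linkSpace k) := by
  intro ψ hψ φ hφ
  rw [sumForm_eq_of_matching hφ.1 hψ, LinearMap.mem_ker.1 hφ.2, map_zero, LinearMap.zero_apply]

theorem perp_linkSpace (hk : k ≠ 0) (h₁ : G₁.IsJost k fp₁ fm₁) (h₂ : G₂.IsJost k fp₂ fm₂) :
    perp (L.sumForm k) (L.linkSpace k) = L.matching k := by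
  classical
  refine le_antisymm (fun ψ hψ => L.mem_matching.2 fun i => ?_) matching_le_perp
  rw [← flipData_flipData (L.cutData₁ k i ψ)]
  congr 1
  refine eq_of_forall_dataWronskian fun u => ?_
  -- Test element of `N` with arbitrary matching data `u` on the linking ray `i` and zero elsewhere.
  obtain ⟨φ, hφ₁, hφ₂, hφ⟩ := exists_sumSpace (L := L) hk h₁ h₂ (Pi.single i (flipData u))
    (Pi.single i u) 0
  have hm : φ ∈ L.matching k := L.mem_matching.2 fun j => by
    rw [hφ₁, hφ₂]
    rcases eq_or_ne j i with rfl | hj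
    · simp
    · simp [hj]
  have h := hψ φ ⟨hm, hφ⟩
  rw [sumForm_eq, hφ, map_zero, LinearMap.zero_apply, add_zero,
    mul_eq_zero_iff_left (inv_ne_zero (by exact_mod_cast hk)), Finset.sum_eq_single i] at h
  · rw [hφ₁, hφ₂, Pi.single_eq_same, Pi.single_eq_same] at h
    rw [← flipData_flipData u, dataWronskian_flip, flipData_flipData]
    linear_combination -h
  · intro j _ hj
    rw [hφ₁, hφ₂, Pi.single_eq_of_ne hj, Pi.single_eq_of_ne hj, dataWronskian_zero_left,
      dataWronskian_zero_left, add_zero]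
  · simp

theorem reducedLift_restrict_bijective (hk : k ≠ 0) (h₁ : G₁.IsJost k fp₁ fm₁)
    (h₂ : G₂.IsJost k fp₂ fm₂) : Function.Bijective
      (reducedLift (L.sumForm k) (L.linkSpace k) (L.restrict k) L.linkSpace_le_ker) := by
  refine reducedLift_bijective _ ?_ fun χ => ?_
  · rw [perp_linkSpace hk h₁ h₂]
    exact le_rfl
  -- Zero data on the linking rays match trivially.
  · obtain ⟨ψ, hψ₁, hψ₂, hψ⟩ := exists_sumSpace (L := L) hk h₁ h₂ 0 0 χ
    have hm : ψ ∈ L.matching k := L.mem_matching.2 fun i => by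
      rw [hψ₁, hψ₂, Pi.zero_apply, map_zero]
    exact ⟨ψ, matching_le_perp hm, hψ⟩

theorem asympForm_reducedLift_restrict (hk : k ≠ 0) (h₁ : G₁.IsJost k fp₁ fm₁)
    (h₂ : G₂.IsJost k fp₂ fm₂) (x y : Reduced (L.sumForm k) (L.linkSpace k)) :
    L.linked.asympForm k
        (reducedLift (L.sumForm k) (L.linkSpace k) (L.restrict k) L.linkSpace_le_ker x)
        (reducedLift (L.sumForm k) (L.linkSpace k) (L.restrict k) L.linkSpace_le_ker y) =
      reducedForm (L.sumForm k) (L.sumForm_skew k) (L.linkSpace k) x y := by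
  have hle := (perp_linkSpace (L := L) hk h₁ h₂).le
  exact form_reducedLift _ _ (fun x hx y hy => (sumForm_eq_of_matching (hle hx) (hle hy)).symm) x y

end Jost

theorem rayPot₁_cut (i : P) : G₁.rayPot (.inl i) (L.a₁ i) = 0 :=
  eq_zero_of_supp (G₁.rayPot_cont _) (L.a₁_nonneg i) (L.supp₁ i)

theorem rayPot₂_cut (i : P) : G₂.rayPot (.inl i) (L.a₂ i) = 0 :=
  eq_zero_of_supp (G₂.rayPot_cont _) (L.a₂_nonneg i) (L.supp₂ i)

/-- Joining the truncated solutions leaves all boundary values at the origins of the linking rays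
unchanged, so both sets of boundary conditions persist. -/
theorem map_restrict_le_eigenplane :
    (L.sumPlane k ⊓ L.matching k).map (L.restrict k) ≤ L.linked.eigenplane k := by
  rintro _ ⟨⟨ψ₁, ψ₂⟩, ⟨⟨⟨⟨ψ₁, η₁⟩, hη₁, rfl⟩, ⟨⟨ψ₂, η₂⟩, hη₂, rfl⟩⟩, hm⟩, rfl⟩
  choose f hf₀ hf using fun i => exists_join (L.a₁_nonneg i) (L.a₂_nonneg i) (L.length_pos i)
    (L.rayPot₁_cut i) (L.rayPot₂_cut i) (ψ₁ (.inl i)) (ψ₂ (.inl i)) (L.mem_matching.1 hm i)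
  let η : L.linked.EdgeSpace k := fun e => match e with
    | .inl (.inl e) => η₁ e
    | .inl (.inr e) => η₂ e
    | .inr i => f i
  refine ⟨(L.restrict k (ψ₁, ψ₂), η), ⟨?_, ?_⟩, rfl⟩
  · change LinearMap.funLeft ℂ (ℂ × ℂ) endPoint₁ _ ∈ G₁.bc
    change G₁.boundaryValues k _ ∈ G₁.bc at hη₁
    convert! hη₁ using 1
    funext v
    rcases v with (i | j) | (e | e)
    · exact hf₀ i
    all_goals rfl
  · change LinearMap.funLeft ℂ (ℂ × ℂ) endPoint₂ _ ∈ G₂.bc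
    change G₂.boundaryValues k _ ∈ G₂.bc at hη₂
    convert! hη₂ using 1
    funext v
    rcases v with (i | j) | (e | e)
    · exact hf i
    all_goals rfl

theorem eigenplane_le_map_restrict {fp₁ fm₁ : G₁.AsympSpace k} {fp₂ fm₂ : G₂.AsympSpace k}
    (hk : k ≠ 0) (h₁ : G₁.IsJost k fp₁ fm₁) (h₂ : G₂.IsJost k fp₂ fm₂) :
    L.linked.eigenplane k ≤ (L.sumPlane k ⊓ L.matching k).map (L.restrict k) := by
  rintro _ ⟨⟨χ, η⟩, ⟨hη₁, hη₂⟩, rfl⟩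
  let f : ∀ i, solSpace (joinPot (G₁.rayPot (.inl i)) (G₂.rayPot (.inl i)) (L.a₁ i) (L.a₂ i))
    (k ^ 2) (Icc 0 (L.a₁ i + L.a₂ i)) := fun i => η (.inr i)
  -- The data of the edge solution at the cut, continued as solutions along both full rays.
  let u : P → ℂ × ℂ := fun i => cauchyData _ (k ^ 2) (Icc 0 (L.a₁ i + L.a₂ i)) (L.a₁ i)
    ⟨L.a₁_nonneg i, le_add_of_nonneg_right (L.a₂_nonneg i)⟩ (f i)
  obtain ⟨ψ, hψ₁, hψ₂, rfl⟩ := exists_sumSpace (L := L) hk h₁ h₂ u (fun i => flipData (u i)) χ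
  refine ⟨ψ, ⟨⟨⟨(ψ.1, fun e => η (.inl (.inl e))), ?_, rfl⟩,
    ⟨(ψ.2, fun e => η (.inl (.inr e))), ?_, rfl⟩⟩, L.mem_matching.2 fun i => ?_⟩, rfl⟩
  · change LinearMap.funLeft ℂ (ℂ × ℂ) endPoint₁ _ ∈ G₁.bc at hη₁
    change G₁.boundaryValues k _ ∈ G₁.bc
    convert! hη₁ using 1
    funext v
    rcases v with (i | j) | (e | e)
    · exact cauchyData_zero_eq_of_join (L.a₁_nonneg i) (L.a₂_nonneg i) (L.length_pos i)
        (G₁.rayPot_cont _) (f i) (ψ.1 (.inl i)) (hψ₁ i)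
    all_goals rfl
  · change LinearMap.funLeft ℂ (ℂ × ℂ) endPoint₂ _ ∈ G₂.bc at hη₂
    change G₂.boundaryValues k _ ∈ G₂.bc
    convert! hη₂ using 1
    funext v
    rcases v with (i | j) | (e | e)
    · exact cauchyData_zero_eq_flip_of_join (L.a₁_nonneg i) (L.a₂_nonneg i) (L.length_pos i)
        (G₂.rayPot_cont _) (L.rayPot₁_cut i) (L.rayPot₂_cut i) (f i) (ψ.2 (.inl i)) (hψ₂ i)
    all_goals rfl
  · rw [hψ₁, hψ₂, flipData_flipData]

end Linking

/-! ### Scattering matrices -/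

open Matrix in
theorem vecMul_inl {l m n o : Type*} [Fintype l] [Fintype m] (S : Matrix (l ⊕ m) (n ⊕ o) ℂ)
    (α : l → ℂ) (β : m → ℂ) (i : n) :
    (Sum.elim α β ᵥ* S) (.inl i) = (α ᵥ* S.toBlocks₁₁) i + (β ᵥ* S.toBlocks₂₁) i := by
  conv_lhs => rw [← Matrix.fromBlocks_toBlocks S]
  simp [Matrix.vecMul_fromBlocks]

open Matrix in
theorem vecMul_inr {l m n o : Type*} [Fintype l] [Fintype m] (S : Matrix (l ⊕ m) (n ⊕ o) ℂ)
    (α : l → ℂ) (β : m → ℂ) (i : o) :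
    (Sum.elim α β ᵥ* S) (.inr i) = (α ᵥ* S.toBlocks₁₂) i + (β ᵥ* S.toBlocks₂₂) i := by
  conv_lhs => rw [← Matrix.fromBlocks_toBlocks S]
  simp [Matrix.vecMul_fromBlocks]

namespace SchrodingerGraph

open Matrix

variable {R E : Type*} [Fintype R] [Fintype E] {G : SchrodingerGraph R E} {k : ℝ}
  {fp fm : G.AsympSpace k}

/-- The combination of Jost solutions with coefficients `α` of `f₋` and `β` of `f₊`. -/
def jostComb (fp fm : G.AsympSpace k) (α β : R → ℂ) : G.AsympSpace k :=
  fun r => solComb (fp r) (fm r) (β r, α r)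

theorem IsJost.jostComb_inj (hJ : G.IsJost k fp fm) (hk : k ≠ 0) {α β α' β' : R → ℂ}
    (h : jostComb fp fm α β = jostComb fp fm α' β') : α = α' ∧ β = β' := by
  have h' : ∀ r, (β r, α r) = (β' r, α' r) := fun r =>
    solComb_injective hk (hJ.1 r) (hJ.2 r) (congrFun h r)
  exact ⟨funext fun r => congrArg Prod.snd (h' r), funext fun r => congrArg Prod.fst (h' r)⟩

theorem IsJost.unique {fp' fm' : G.AsympSpace k} (hJ : G.IsJost k fp fm)
    (hJ' : G.IsJost k fp' fm') (hk : k ≠ 0) : fp' = fp ∧ fm' = fm :=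
  ⟨funext fun r => jost_unique hk (G.rayPot_cont r) (hJ.1 r) (hJ.2 r) (hJ'.1 r),
    funext fun r => jost_unique (neg_ne_zero.2 hk) (G.rayPot_cont r) (hJ.2 r)
      (by rw [neg_neg]; exact hJ.1 r) (hJ'.2 r)⟩

variable [DecidableEq R]

theorem scatteringWave_eq (S : Matrix R R ℂ) (i : R) :
    G.scatteringWave k fp fm S i = jostComb fp fm (Pi.single i 1) (S i) := by
  funext r
  have h₁ : (Pi.single i (fm i) : G.AsympSpace k) r = (Pi.single i 1 : R → ℂ) r • fm r := by
    rcases eq_or_ne r i with rfl | hr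
    · simp
    · simp [hr]
  have h₂ : (∑ j, S i j • (Pi.single j (fp j) : G.AsympSpace k)) r = S i r • fp r := by
    rw [Finset.sum_apply, Finset.sum_eq_single r]
    · simp
    · intro j _ hj
      simp [Pi.single_eq_of_ne hj.symm]
    · simp
  rw [jostComb, solComb_apply, scatteringWave, Pi.add_apply, h₁, h₂, add_comm]

/-- Incoming coefficients are row vectors, on which `S` acts from the right to give the outgoing
ones. -/
theorem sum_scatteringWave (S : Matrix R R ℂ) (α : R → ℂ) :
    ∑ i, α i • G.scatteringWave k fp fm S i = jostComb fp fm α (α ᵥ* S) := by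
  funext r
  rw [Finset.sum_apply]
  simp only [Pi.smul_apply, scatteringWave_eq, jostComb, ← map_smul]
  rw [← map_sum]
  congr 1
  refine Prod.ext ?_ ?_
  · simp [Prod.fst_sum, Matrix.vecMul, dotProduct]
  · simp [Prod.snd_sum, Pi.single_apply]

theorem mem_span_scatteringWave {S : Matrix R R ℂ} {ψ : G.AsympSpace k} :
    ψ ∈ Submodule.span ℂ (range (G.scatteringWave k fp fm S)) ↔
      ∃ α : R → ℂ, jostComb fp fm α (α ᵥ* S) = ψ := by
  simp only [Submodule.mem_span_range_iff_exists_fun, sum_scatteringWave]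

theorem IsJost.linearIndependent (hJ : G.IsJost k fp fm) (hk : k ≠ 0) (S : Matrix R R ℂ) :
    LinearIndependent ℂ (G.scatteringWave k fp fm S) := by
  refine Fintype.linearIndependent_iff.2 fun α h i => ?_
  rw [sum_scatteringWave] at h
  have h0 : jostComb fp fm (0 : R → ℂ) 0 = 0 := funext fun r => map_zero _
  exact congrFun (hJ.jostComb_inj hk (h.trans h0.symm)).1 i

/-- The Jost solutions are unique, and an element of the span is determined by its `f₋`
coefficients; those of the `i`-th wave are the `i`-th unit vector, which fixes row `i`. -/
theorem IsJost.isScatteringMatrix_iff (hJ : G.IsJost k fp fm) (hk : k ≠ 0) {S : Matrix R R ℂ}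
    (hS : Submodule.span ℂ (range (G.scatteringWave k fp fm S)) = G.eigenplane k)
    (T : Matrix R R ℂ) : G.IsScatteringMatrix k T ↔ T = S := by
  constructor
  · rintro ⟨gp, gm, hp, hm, -, hT⟩
    obtain ⟨rfl, rfl⟩ := hJ.unique ⟨hp, hm⟩ hk
    rw [← hS] at hT
    funext i
    have hi : G.scatteringWave k gp gm T i ∈
        Submodule.span ℂ (range (G.scatteringWave k gp gm S)) := by
      rw [← hT]
      exact Submodule.subset_span ⟨i, rfl⟩
    obtain ⟨α, hα⟩ := mem_span_scatteringWave.1 hi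
    rw [scatteringWave_eq] at hα
    obtain ⟨rfl, h⟩ := hJ.jostComb_inj hk hα
    rw [← h, Matrix.single_one_vecMul]
    rfl
  · rintro rfl
    exact ⟨fp, fm, hJ.1, hJ.2, hJ.linearIndependent hk T, hS⟩

end SchrodingerGraph

/-! ### The scattering matrix of the linked graph -/

namespace Linking

open Matrix SchrodingerGraph

variable {P N₁ N₂ E₁ E₂ : Type*} [Fintype P] [Fintype N₁] [Fintype N₂] [Fintype E₁]
  [Fintype E₂] {G₁ : SchrodingerGraph (P ⊕ N₁) E₁} {G₂ : SchrodingerGraph (P ⊕ N₂) E₂}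
  {L : Linking G₁ G₂} {k : ℝ} {fp₁ fm₁ : G₁.AsympSpace k} {fp₂ fm₂ : G₂.AsympSpace k}

theorem isJost_restrict (h₁ : G₁.IsJost k fp₁ fm₁) (h₂ : G₂.IsJost k fp₂ fm₂) :
    L.linked.IsJost k (L.restrict k (fp₁, fp₂)) (L.restrict k (fm₁, fm₂)) := by
  refine ⟨?_, ?_⟩
  · rintro (j | j)
    · exact h₂.1 _
    · exact h₁.1 _
  · rintro (j | j)
    · exact h₂.2 _
    · exact h₁.2 _

theorem restrict_jostComb (α₁ β₁ : P ⊕ N₁ → ℂ) (α₂ β₂ : P ⊕ N₂ → ℂ) :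
    L.restrict k (jostComb fp₁ fm₁ α₁ β₁, jostComb fp₂ fm₂ α₂ β₂) =
      jostComb (L.restrict k (fp₁, fp₂)) (L.restrict k (fm₁, fm₂))
        (Sum.elim (α₂ ∘ Sum.inr) (α₁ ∘ Sum.inr)) (Sum.elim (β₂ ∘ Sum.inr) (β₁ ∘ Sum.inr)) := by
  funext r
  rcases r with j | j <;> rfl

/-- Cauchy data at `a` of a combination of Jost solutions of a potential that vanishes
beyond `a`. -/
theorem cauchyData_solComb {k : ℝ} (hk : k ≠ 0) {q : ℝ → ℝ} {a : ℝ} (ha : 0 ≤ a)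
    (hq : ∀ x, a ≤ x → q x = 0) {fp fm : solSpace q (k ^ 2) (Ici 0)} (hp : AsympExp k fp.1)
    (hm : AsympExp (-k) fm.1) (c : ℂ × ℂ) :
    cauchyData q (k ^ 2) (Ici 0) a ha (solComb fp fm c) =
      (c.1 * exp (I * k * a) + c.2 * (exp (I * k * a))⁻¹,
        I * k * (c.1 * exp (I * k * a) - c.2 * (exp (I * k * a))⁻¹)) := by
  have e : exp (I * (-k : ℝ) * a) = (exp (I * k * a))⁻¹ := by
    rw [← Complex.exp_neg]
    congr 1
    push_cast
    ring
  rw [solComb_apply, map_add, map_smul, map_smul, cauchyData_eq_exp hk rfl ha hq fp hp,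
    cauchyData_eq_exp (neg_ne_zero.2 hk) (neg_sq k).symm ha hq fm hm, e]
  refine Prod.ext rfl ?_
  simp only [Prod.snd_add, Prod.smul_snd, smul_eq_mul]
  push_cast
  ring

/-- A wave leaving one graph along a linking edge enters the other, with the phase collected over
the length of the edge. -/
theorem jostComb_mem_matching (hk : k ≠ 0) (h₁ : G₁.IsJost k fp₁ fm₁)
    (h₂ : G₂.IsJost k fp₂ fm₂) (α₁ β₁ : P ⊕ N₁ → ℂ) (α₂ β₂ : P ⊕ N₂ → ℂ) :
    (jostComb fp₁ fm₁ α₁ β₁, jostComb fp₂ fm₂ α₂ β₂) ∈ L.matching k ↔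
      ∀ i, exp (-(I * k * (L.a₁ i + L.a₂ i : ℝ))) * α₁ (.inl i) = β₂ (.inl i) ∧
        exp (-(I * k * (L.a₁ i + L.a₂ i : ℝ))) * α₂ (.inl i) = β₁ (.inl i) := by
  rw [mem_matching]
  refine forall_congr' fun i => ?_
  have c₁ : L.cutData₁ k i (jostComb fp₁ fm₁ α₁ β₁, jostComb fp₂ fm₂ α₂ β₂) = _ :=
    cauchyData_solComb hk (L.a₁_nonneg i) (fun x hx => hx.eq_or_lt.elim
      (fun h => h ▸ L.rayPot₁_cut i) (L.supp₁ i x)) (h₁.1 _) (h₁.2 _) _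
  have c₂ : L.cutData₂ k i (jostComb fp₁ fm₁ α₁ β₁, jostComb fp₂ fm₂ α₂ β₂) = _ :=
    cauchyData_solComb hk (L.a₂_nonneg i) (fun x hx => hx.eq_or_lt.elim
      (fun h => h ▸ L.rayPot₂_cut i) (L.supp₂ i x)) (h₂.1 _) (h₂.2 _) _
  have e : exp (-(I * k * (L.a₁ i + L.a₂ i : ℝ))) =
      (exp (I * k * L.a₁ i))⁻¹ * (exp (I * k * L.a₂ i))⁻¹ := by
    rw [← Complex.exp_neg, ← Complex.exp_neg, ← Complex.exp_add]
    congr 1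
    push_cast
    ring
  rw [c₁, c₂, e]
  have hx := Complex.exp_ne_zero (I * k * L.a₁ i)
  have hy := Complex.exp_ne_zero (I * k * L.a₂ i)
  have hIk : (I * k : ℂ) ≠ 0 := mul_ne_zero Complex.I_ne_zero (by exact_mod_cast hk)
  generalize exp (I * k * L.a₁ i) = x at *
  generalize exp (I * k * L.a₂ i) = y at *
  simp only [flipData, LinearMap.prodMap_apply, LinearMap.id_apply, LinearMap.neg_apply,
    Prod.mk.injEq]
  rw [← mul_neg, mul_right_inj' hIk]
  have hx' : x * x⁻¹ = 1 := mul_inv_cancel₀ hx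
  have hy' : y * y⁻¹ = 1 := mul_inv_cancel₀ hy
  -- Sums and differences of the value and derivative equations separate the two directions of
  -- travel.
  constructor
  · rintro ⟨h, h'⟩
    constructor
    · linear_combination y⁻¹ * (h - h') / 2 + β₂ (.inl i) * hy'
    · linear_combination -x⁻¹ * (h + h') / 2 + β₁ (.inl i) * hx'
  · rintro ⟨h, h'⟩
    constructor
    · linear_combination y * h - x * h' - α₁ (.inl i) * x⁻¹ * hy' + α₂ (.inl i) * y⁻¹ * hx'
    · linear_combination -y * h - x * h' + α₁ (.inl i) * x⁻¹ * hy' + α₂ (.inl i) * y⁻¹ * hx'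

/-- Here `γ` holds the incoming amplitudes on the remaining rays and `δ` those on the linking rays
of both graphs: the first equation is matching, and the second collects the outgoing amplitudes. -/
theorem mem_map_restrict_iff [DecidableEq P] [DecidableEq N₁] [DecidableEq N₂] (hk : k ≠ 0)
    (h₁ : G₁.IsJost k fp₁ fm₁) (h₂ : G₂.IsJost k fp₂ fm₂) {S₁ : Matrix (P ⊕ N₁) (P ⊕ N₁) ℂ}
    {S₂ : Matrix (P ⊕ N₂) (P ⊕ N₂) ℂ}
    (hS₁ : Submodule.span ℂ (range (G₁.scatteringWave k fp₁ fm₁ S₁)) = G₁.eigenplane k)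
    (hS₂ : Submodule.span ℂ (range (G₂.scatteringWave k fp₂ fm₂ S₂)) = G₂.eigenplane k)
    {χ : L.linked.AsympSpace k} :
    χ ∈ (L.sumPlane k ⊓ L.matching k).map (L.restrict k) ↔
      ∃ (γ : N₂ ⊕ N₁ → ℂ) (δ : P ⊕ P → ℂ),
        δ ᵥ* L.linkMatrix k S₁ S₂ = γ ᵥ* Matrix.fromBlocks S₂.toBlocks₂₁ 0 0 S₁.toBlocks₂₁ ∧
        jostComb (L.restrict k (fp₁, fp₂)) (L.restrict k (fm₁, fm₂)) γ
          (γ ᵥ* Matrix.fromBlocks S₂.toBlocks₂₂ 0 0 S₁.toBlocks₂₂ +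
            δ ᵥ* Matrix.fromBlocks 0 S₁.toBlocks₁₂ S₂.toBlocks₁₂ 0) = χ := by
  have key : ∀ (γ : N₂ ⊕ N₁ → ℂ) (δ : P ⊕ P → ℂ) (α₁ : P ⊕ N₁ → ℂ) (α₂ : P ⊕ N₂ → ℂ),
      α₁ = Sum.elim (δ ∘ Sum.inl) (γ ∘ Sum.inr) → α₂ = Sum.elim (δ ∘ Sum.inr) (γ ∘ Sum.inl) →
      ((jostComb fp₁ fm₁ α₁ (α₁ ᵥ* S₁), jostComb fp₂ fm₂ α₂ (α₂ ᵥ* S₂)) ∈ L.matching k ↔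
        δ ᵥ* L.linkMatrix k S₁ S₂ = γ ᵥ* Matrix.fromBlocks S₂.toBlocks₂₁ 0 0 S₁.toBlocks₂₁) ∧
      L.restrict k (jostComb fp₁ fm₁ α₁ (α₁ ᵥ* S₁), jostComb fp₂ fm₂ α₂ (α₂ ᵥ* S₂)) =
        jostComb (L.restrict k (fp₁, fp₂)) (L.restrict k (fm₁, fm₂)) γ
          (γ ᵥ* Matrix.fromBlocks S₂.toBlocks₂₂ 0 0 S₁.toBlocks₂₂ +
            δ ᵥ* Matrix.fromBlocks 0 S₁.toBlocks₁₂ S₂.toBlocks₁₂ 0) := by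
    rintro γ δ _ _ rfl rfl
    refine ⟨?_, ?_⟩
    · rw [jostComb_mem_matching hk h₁ h₂, forall_and, funext_iff, Sum.forall]
      refine and_congr (forall_congr' fun i => ?_) (forall_congr' fun i => ?_)
      · rw [vecMul_inl, linkMatrix, zeta, Matrix.vecMul_fromBlocks, Matrix.vecMul_fromBlocks]
        simp only [Sum.elim_inl, Pi.add_apply, Matrix.vecMul_diagonal, Matrix.vecMul_neg,
          Pi.neg_apply, Matrix.vecMul_zero, Pi.zero_apply, Function.comp_apply]
        constructor <;> intro h <;> linear_combination h
      · rw [vecMul_inl, linkMatrix, zeta, Matrix.vecMul_fromBlocks, Matrix.vecMul_fromBlocks]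
        simp only [Sum.elim_inl, Sum.elim_inr, Pi.add_apply, Matrix.vecMul_diagonal,
          Matrix.vecMul_neg, Pi.neg_apply, Matrix.vecMul_zero, Pi.zero_apply, Function.comp_apply]
        constructor <;> intro h <;> linear_combination h
    · rw [restrict_jostComb]
      congr 1
      · funext r
        rcases r with j | j <;> rfl
      · funext r
        rw [Matrix.vecMul_fromBlocks, Matrix.vecMul_fromBlocks]
        rcases r with j | j
        · simp [vecMul_inr, add_comm]
        · simp [vecMul_inr, add_comm]
  constructor
  · rintro ⟨⟨ψ₁, ψ₂⟩, ⟨⟨hψ₁, hψ₂⟩, hm⟩, rfl⟩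
    change ψ₁ ∈ G₁.eigenplane k at hψ₁
    change ψ₂ ∈ G₂.eigenplane k at hψ₂
    rw [← hS₁, mem_span_scatteringWave] at hψ₁
    rw [← hS₂, mem_span_scatteringWave] at hψ₂
    obtain ⟨α₁, rfl⟩ := hψ₁
    obtain ⟨α₂, rfl⟩ := hψ₂
    obtain ⟨hk₁, hk₂⟩ := key (Sum.elim (α₂ ∘ Sum.inr) (α₁ ∘ Sum.inr))
      (Sum.elim (α₁ ∘ Sum.inl) (α₂ ∘ Sum.inl)) α₁ α₂ (by simp) (by simp)
    exact ⟨_, _, hk₁.1 hm, hk₂.symm⟩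
  · rintro ⟨γ, δ, h, rfl⟩
    obtain ⟨hk₁, hk₂⟩ := key γ δ _ _ rfl rfl
    refine ⟨_, ⟨⟨?_, ?_⟩, hk₁.2 h⟩, hk₂⟩
    · change _ ∈ G₁.eigenplane k
      rw [← hS₁, mem_span_scatteringWave]
      exact ⟨_, rfl⟩
    · change _ ∈ G₂.eigenplane k
      rw [← hS₂, mem_span_scatteringWave]
      exact ⟨_, rfl⟩

/-- When the link matrix is invertible, `γ` is arbitrary and determines `δ`, which is then
substituted into the outgoing amplitudes. -/
theorem span_scatteringWave_linked [DecidableEq P] [DecidableEq N₁] [DecidableEq N₂] (hk : k ≠ 0)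
    (h₁ : G₁.IsJost k fp₁ fm₁) (h₂ : G₂.IsJost k fp₂ fm₂) {S₁ : Matrix (P ⊕ N₁) (P ⊕ N₁) ℂ}
    {S₂ : Matrix (P ⊕ N₂) (P ⊕ N₂) ℂ}
    (hS₁ : Submodule.span ℂ (range (G₁.scatteringWave k fp₁ fm₁ S₁)) = G₁.eigenplane k)
    (hS₂ : Submodule.span ℂ (range (G₂.scatteringWave k fp₂ fm₂ S₂)) = G₂.eigenplane k)
    (hu : IsUnit (L.linkMatrix k S₁ S₂)) :
    Submodule.span ℂ (range (L.linked.scatteringWave k (L.restrict k (fp₁, fp₂))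
      (L.restrict k (fm₁, fm₂)) (Matrix.fromBlocks S₂.toBlocks₂₂ 0 0 S₁.toBlocks₂₂ +
          Matrix.fromBlocks S₂.toBlocks₂₁ 0 0 S₁.toBlocks₂₁ * (L.linkMatrix k S₁ S₂)⁻¹ *
            Matrix.fromBlocks 0 S₁.toBlocks₁₂ S₂.toBlocks₁₂ 0))) =
      (L.sumPlane k ⊓ L.matching k).map (L.restrict k) := by
  have hdet := (Matrix.isUnit_iff_isUnit_det _).1 hu
  ext χ
  rw [mem_span_scatteringWave, mem_map_restrict_iff hk h₁ h₂ hS₁ hS₂]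
  refine exists_congr fun γ => ?_
  rw [Matrix.vecMul_add, ← Matrix.vecMul_vecMul, ← Matrix.vecMul_vecMul]
  constructor
  · rintro rfl
    refine ⟨_, ?_, rfl⟩
    rw [Matrix.vecMul_vecMul, Matrix.nonsing_inv_mul _ hdet, Matrix.vecMul_one]
  · rintro ⟨δ, hδ, rfl⟩
    rw [← hδ, Matrix.vecMul_vecMul δ, Matrix.mul_nonsing_inv _ hdet, Matrix.vecMul_one]

end Linking

end

theorem mainTheorem1 {P N₁ N₂ E₁ E₂ : Type*}
    [Fintype P] [DecidableEq P] [Fintype N₁] [DecidableEq N₁] [Fintype N₂] [DecidableEq N₂]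
    [Fintype E₁] [Fintype E₂]
    (G₁ : SchrodingerGraph (P ⊕ N₁) E₁) (G₂ : SchrodingerGraph (P ⊕ N₂) E₂)
    (L : Linking G₁ G₂) (k : ℝ) (hk : k ≠ 0)
    (S₁ : Matrix (P ⊕ N₁) (P ⊕ N₁) ℂ) (S₂ : Matrix (P ⊕ N₂) (P ⊕ N₂) ℂ)
    (hS₁ : G₁.IsScatteringMatrix k S₁) (hS₂ : G₂.IsScatteringMatrix k S₂) :
    -- the space `N` is isotropic and its complement consists of the matching elements
    L.linkSpace k ≤ perp (L.sumForm k) (L.linkSpace k) ∧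
    perp (L.sumForm k) (L.linkSpace k) = L.matching k ∧
    -- `(L_m ∩ N^⊥) / N` is a Lagrange plane in `N^⊥ / N`
    IsLagrange (reducedForm (L.sumForm k) (L.sumForm_skew k) (L.linkSpace k))
      (reducedPlane (L.sumForm k) (L.linkSpace k) (L.sumPlane k)) ∧
    -- restriction to the rays of the linked graph identifies `N^⊥ / N` with the asymptotic space
    -- of the linked graph, and this Lagrange plane with its generalised eigenspace
    (∃ e : Reduced (L.sumForm k) (L.linkSpace k) ≃ₗ[ℂ] L.linked.AsympSpace k,
      (∀ ψ : perp (L.sumForm k) (L.linkSpace k),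
        e (Submodule.Quotient.mk ψ) = L.restrict k ψ.1) ∧
      (∀ x y, L.linked.asympForm k (e x) (e y) =
        reducedForm (L.sumForm k) (L.sumForm_skew k) (L.linkSpace k) x y) ∧
      (reducedPlane (L.sumForm k) (L.linkSpace k) (L.sumPlane k)).map e.toLinearMap =
        L.linked.eigenplane k) ∧
    -- the factorisation formula
    (IsUnit (L.linkMatrix k S₁ S₂) →
      ∀ S : Matrix (N₂ ⊕ N₁) (N₂ ⊕ N₁) ℂ, L.linked.IsScatteringMatrix k S ↔
        S = Matrix.fromBlocks S₂.toBlocks₂₂ 0 0 S₁.toBlocks₂₂ +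
          Matrix.fromBlocks S₂.toBlocks₂₁ 0 0 S₁.toBlocks₂₁ * (L.linkMatrix k S₁ S₂)⁻¹ *
            Matrix.fromBlocks 0 S₁.toBlocks₁₂ S₂.toBlocks₁₂ 0) := by
  obtain ⟨fp₁, fm₁, hp₁, hm₁, hi₁, hs₁⟩ := id hS₁
  obtain ⟨fp₂, fm₂, hp₂, hm₂, hi₂, hs₂⟩ := id hS₂
  have h₁ : G₁.IsJost k fp₁ fm₁ := ⟨hp₁, hm₁⟩
  have h₂ : G₂.IsJost k fp₂ fm₂ := ⟨hp₂, hm₂⟩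
  have hperp := Linking.perp_linkSpace (L := L) hk h₁ h₂
  have hN : L.linkSpace k ≤ perp (L.sumForm k) (L.linkSpace k) :=
    inf_le_left.trans Linking.matching_le_perp
  have hplane : L.linked.eigenplane k = (L.sumPlane k ⊓ L.matching k).map (L.restrict k) :=
    le_antisymm (L.eigenplane_le_map_restrict hk h₁ h₂) L.map_restrict_le_eigenplane
  refine ⟨hN, hperp, ?_, ?_, fun hu S => ?_⟩
  · exact reducedPlane_isLagrange (L.sumForm_skew k)
      (L.sumForm_surjective (h₁.asympForm_surjective hk) (h₂.asympForm_surjective hk)) hN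
      (L.sumPlane_isLagrange (hS₁.isLagrange_eigenplane hk) (hS₂.isLagrange_eigenplane hk))
  · refine ⟨LinearEquiv.ofBijective _ (Linking.reducedLift_restrict_bijective hk h₁ h₂),
      fun ψ => rfl, Linking.asympForm_reducedLift_restrict hk h₁ h₂, ?_⟩
    rw [hplane, ← hperp]
    exact map_reducedLift_reducedPlane L.linkSpace_le_ker (L.sumPlane k)
  -- Potentials on the remaining rays are unchanged, so the restricted Jost solutions are those of
  -- the linked graph.
  · refine (Linking.isJost_restrict h₁ h₂).isScatteringMatrix_iff hk ?_ S
    rw [hplane]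
    exact Linking.span_scatteringWave_linked hk h₁ h₂ hs₁ hs₂ hu
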